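/- Let $k$ be a field and $S = k[x_1,\dots,x_N]$. A quadratic binomial is a homogeneous polynomial of degree $2$ with exactly two terms (with arbitrary nonzero coefficients in $k$). Let $F \subset S$ be a set of quadratic binomials, each of which is a prime element of $S$ and none of which has the form $\alpha x_i^2 + \beta x_j^2$ with $\alpha,\beta\in k$ (the latter is automatic if $k$ is algebraically closed), and suppose that $F$ minimally generates the ideal $(F)$, i.e. no $f \in F$ lies in the ideal generated by $F \setminus \{f\}$. We say that $F$ is a Gröbner basis with respect to a term order if the leading terms of the elements of $F$ generate the initial ideal of $(F)$. An irreducible robust component of $F$ is a nonempty subset $G \subseteq F$ such that $F = G \cup H$ for some set $H$ of polynomials having no variable in common with those in $G$, and such that $G$ itself is not the union of two nonempty sets of polynomials in disjoint sets of variables. Then the following are equivalent: 1. $F$ is a Gröbner basis with respect to every lexicographic term order (for every ordering of the variables). 2. $F$ is a Gröbner basis with respect to every term order. 3. $(F)$ is a prime ideal, and every irreducible robust component $G$ of $F$ either consists of a single polynomial (a hypersurface) or generates a generic determinantal ideal up to a rescaling of the variables, that is, the ideal of $2\times 2$ minors of a matrix $$\begin{pmatrix} \lambda_1 y_1 & \cdots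 & \lambda_n y_n \\ \mu_1 z_1 & \cdots & \mu_n z_n\end{pmatrix},\qquad n \ge 2,$$ where $y_1,\dots,y_n,z_1,\dots,z_n$ are $2n$ distinct variables of $S$ and all $\lambda_i,\mu_i\in k$ are nonzero. -/

import Mathlib

universe u v

/-- A quadratic binomial: a homogeneous polynomial of degree two with exactly two terms
(the two nonzero coefficients are arbitrary). -/
def IsQuadraticBinomial {σ : Type u} {k : Type v} [Field k] (f : MvPolynomial σ k) : Prop :=
  f.IsHomogeneous 2 ∧ f.support.card = 2

/-- `F` minimally generates the ideal `(F)`: no element of `F` is redundant. -/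
def IsMinimalGeneratingSet {σ : Type u} {k : Type v} [Field k]
    (F : Set (MvPolynomial σ k)) : Prop :=
  ∀ f ∈ F, f ∉ Ideal.span (F \ {f})

/-- `F` is a Gröbner basis (of the ideal it generates) with respect to the term order `m`:
the leading terms of the elements of `F` generate the initial ideal of `(F)`. -/
def IsGroebnerBasis {σ : Type u} {k : Type v} [Field k] (m : MonomialOrder.{u, u} σ)
    (F : Set (MvPolynomial σ k)) : Prop :=
  Ideal.span (m.leadingTerm '' (Ideal.span F : Set (MvPolynomial σ k))) =
    Ideal.span (m.leadingTerm '' F)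

/-- The set of variables that occur in the polynomials of `F`. -/
def variablesOf {σ : Type u} {k : Type v} [Field k] (F : Set (MvPolynomial σ k)) : Set σ :=
  {i | ∃ f ∈ F, i ∈ f.vars}

/-- `F` is the union of `G` and `H`, whose polynomials involve disjoint sets of variables. -/
def IsVariableDecomposition {σ : Type u} {k : Type v} [Field k]
    (F G H : Set (MvPolynomial σ k)) : Prop :=
  F = G ∪ H ∧ Disjoint (variablesOf G) (variablesOf H)

/-- `G` is an irreducible component of `F`: it is a nonempty part of a decomposition of `F` into
sets of polynomials in disjoint sets of variables, and has itself no nontrivial such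
decomposition. -/
def IsIrreducibleComponent {σ : Type u} {k : Type v} [Field k]
    (F G : Set (MvPolynomial σ k)) : Prop :=
  G.Nonempty ∧ (∃ H, IsVariableDecomposition F G H) ∧
    ∀ A B, IsVariableDecomposition G A B → A = ∅ ∨ B = ∅

/-- The ideal generated by the `2 × 2` minors of a matrix with two rows. -/
def twoMinorsIdeal {R : Type*} [CommRing R] {n : ℕ} (A : Matrix (Fin 2) (Fin n) R) : Ideal R :=
  Ideal.span {d | ∃ i j : Fin n, i < j ∧ d = (A.submatrix id ![i, j]).det}

/-- `I` is, up to a rescaling of the variables, the ideal of `2 × 2` minors of a generic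
`2 × n` matrix: the `2n` entries are nonzero scalar multiples of `2n` distinct variables. -/
def IsGenericDeterminantal {σ : Type u} {k : Type v} [Field k]
    (I : Ideal (MvPolynomial σ k)) : Prop :=
  ∃ (n : ℕ) (x : Fin 2 → Fin n → σ) (c : Fin 2 → Fin n → k),
    2 ≤ n ∧ Function.Injective (Function.uncurry x) ∧ (∀ r j, c r j ≠ 0) ∧
      I = twoMinorsIdeal
        (Matrix.of fun r j => MvPolynomial.C (c r j) * MvPolynomial.X (x r j))

/-- A combinatorial model of a lexicographically robust set of quadratic binomials: `E a b c d`
records a binomial with terms `ab` and `cd`, and `C a b c d e f` says that the cubic monomials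
`abc` and `def` agree up to a unit modulo the ideal. -/
structure QuadricSystem (σ : Type*) where
  E : σ → σ → σ → σ → Prop
  C : σ → σ → σ → σ → σ → σ → Prop
  symm : ∀ {a b c d}, E a b c d → E c d a b
  comm : ∀ {a b c d}, E a b c d → E b a c d
  disj : ∀ {a b c d}, E a b c d → a ≠ c
  nonsq : ∀ {a c}, ¬ E a a c c
  uniq : ∀ {a b c d c' d'}, E a b c d → E a b c' d' → (c = c' ∧ d = d') ∨ (c = d' ∧ d = c')
  csymm : ∀ {a b c d e f}, C a b c d e f → C d e f a b c
  cswap : ∀ {a b c d e f}, C a b c d e f → C b a c d e f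
  crot : ∀ {a b c d e f}, C a b c d e f → C b c a d e f
  spair : ∀ {x a b p q r s}, E x a p q → E x b r s → C b p q a r s
  step : ∀ {a b c x y z v w}, C a b c x y z → E x y v w → C a b c v w z
  -- Gröbner reduction for a lex order in which absent variables come first, then `a`, then `z`: a
  -- leading term divides `abc`, and its partner uses only present variables other than `a`. The
  -- free choice of `z` serves to exclude a known binomial with term `bc` whose partner contains
  -- `z`.
  red : ∀ {a b c d e f}, C a b c d e f → ∀ z, a ≠ d → a ≠ e → a ≠ f →
    ∃ k l, k ≠ a ∧ l ≠ a ∧ (k = b ∨ k = c ∨ k = d ∨ k = e ∨ k = f) ∧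
      (l = b ∨ l = c ∨ l = d ∨ l = e ∨ l = f) ∧
      (E a b k l ∨ E a c k l ∨ (E b c k l ∧ (a = b ∨ a = c ∨ (k ≠ z ∧ l ≠ z))))
  -- Here `d = a` is allowed: the degree in `a` still drops, from at least two to at most one.
  red_sq : ∀ {a b d e f}, C a a b d e f → a ≠ e → a ≠ f →
    ∃ k l, k ≠ a ∧ l ≠ a ∧ (k = b ∨ k = d ∨ k = e ∨ k = f) ∧
      (l = b ∨ l = d ∨ l = e ∨ l = f) ∧ (E a a k l ∨ E a b k l)

/-! ### Binomials with a square term are isolated -/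

namespace QuadricSystem

variable {σ : Type*} (Q : QuadricSystem σ)

theorem comm' {a b c d : σ} (h : Q.E a b c d) : Q.E a b d c := Q.symm (Q.comm (Q.symm h))

theorem cswap' {a b c d e f : σ} (h : Q.C a b c d e f) : Q.C a b c e d f :=
  Q.csymm (Q.cswap (Q.csymm h))

theorem crot' {a b c d e f : σ} (h : Q.C a b c d e f) : Q.C a b c e f d :=
  Q.csymm (Q.crot (Q.csymm h))

theorem ne_all {a b c d : σ} (h : Q.E a b c d) : a ≠ c ∧ a ≠ d ∧ b ≠ c ∧ b ≠ d :=
  ⟨Q.disj h, Q.disj (Q.comm' h), Q.disj (Q.comm h), Q.disj (Q.comm (Q.comm' h))⟩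

theorem sq_sq_ne {a b c d : σ} (h : Q.E a b c d) : ¬ (a = b ∧ c = d) := by
  rintro ⟨rfl, rfl⟩; exact Q.nonsq h

attribute [grind →] ne_all
attribute [grind →] uniq sq_sq_ne
attribute [grind →] comm symm

/-- The overlap of `pq` with `bp` gives `bxx ≡ qvw`; making `b` greatest confines `r` and `s` to
`q`, `v`, `w`. The few remaining shapes die by further forced reductions. -/
theorem sq_false_aux {x b p q r s v w : σ} (h1 : Q.E x x p q) (h2 : Q.E x b r s) (hbx : b ≠ x)
    (hbp : b ≠ p) (hbq : b ≠ q) (h3 : Q.E b p v w)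
    (hv : v = q ∨ v = x ∨ v = r ∨ v = s) (hw : w = q ∨ w = x ∨ w = r ∨ w = s)
    (S0 : Q.C b p q x r s) : False := by
  have hpq : p ≠ q := by rintro rfl; exact Q.nonsq h1
  have hr : r = q ∨ r = v ∨ r = w := by
    obtain ⟨k, l, H⟩ := Q.red (Q.spair (Q.symm h1) (Q.comm h3)) b (by grind) (by grind) (by grind)
    grind
  have hs : s = q ∨ s = v ∨ s = w := by
    obtain ⟨k, l, H⟩ := Q.red (Q.spair (Q.symm h1) (Q.comm h3)) b (by grind) (by grind) (by grind)
    grind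
  have S2 : Q.C x r s v w q := Q.step (Q.csymm S0) h3
  have key : ∀ t, Q.E x b t q → t ≠ q → Q.E b p x t → False := by
    intro t ht htq hb
    have T := Q.csymm (Q.spair ht (Q.symm hb))
    have hbb : Q.E b b p t := by
      obtain ⟨k, l, H⟩ := Q.red T b (by grind) (by grind) (by grind)
      grind
    obtain ⟨k, l, H⟩ := Q.red (Q.crot (Q.crot (Q.csymm (Q.step (Q.csymm T) hbb))))
      p (by grind) (by grind) (by grind)
    grind
  by_cases hrs : r = s
  · subst hrs
    by_cases hrq : r = q
    · subst hrq
      have h3' : Q.E b p x r := by grind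
      obtain ⟨k, l, H⟩ := Q.red (Q.spair (Q.symm h3') h2) b (by grind) (by grind) (by grind)
      grind
    · by_cases hx : v = x ∨ w = x
      · have T : Q.C q x r x r r := by
          rcases hx with rfl | rfl
          · obtain rfl : w = r := by grind
            exact Q.crot (Q.crot (Q.csymm S2))
          · obtain rfl : v = r := by grind
            clear * - S2; have := @Q.cswap; have := @Q.crot; have := @Q.csymm; grind only
        obtain ⟨k, l, H⟩ := Q.red T q (by grind) (by grind) (by grind)
        grind
      · obtain ⟨k, l, H⟩ := Q.red S2 x (by grind) (by grind) (by grind)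
        have hrr : Q.E x r q q := by grind
        obtain ⟨k, l, H⟩ := Q.red (Q.spair h2 hrr) r (by grind) (by grind) (by grind)
        grind
  · have hq : r = q ∨ s = q := by grind
    by_cases hx : v = x ∨ w = x
    · rcases hq with rfl | rfl
      · exact key s (Q.comm' h2) (by grind) (by grind)
      · exact key r h2 (by grind) (by grind)
    · obtain ⟨t, ht, htq, hv, hw⟩ : ∃ t, Q.E x b t q ∧ t ≠ q ∧ v = t ∧ w = t := by grind
      have S3 : Q.C x t q t t q := by
        rcases hq with rfl | rfl
        · obtain rfl : s = t := by grind
          rw [hv, hw] at S2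
          clear * - S2; have := @Q.cswap; have := @Q.crot; have := @Q.csymm; grind only
        · obtain rfl : r = t := by grind
          rw [hv, hw] at S2
          exact S2
      obtain ⟨k, l, H⟩ := Q.red S3 x (by grind) (by grind) (by grind)
      have hrr : Q.E x t q q := by grind
      obtain ⟨k, l, H⟩ := Q.red (Q.step (Q.csymm S3) hrr) t (by grind) (by grind) (by grind)
      grind

theorem sq_false_of_ne {x b p q r s : σ} (h1 : Q.E x x p q) (h2 : Q.E x b r s) (hbx : b ≠ x)
    (hbp : b ≠ p) (hbq : b ≠ q) : False := by
  have S0 := Q.spair h1 h2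
  -- The choice `z = x` discards the reduction by `pq`, whose partner is `xx`.
  obtain ⟨k, l, H⟩ := Q.red S0 x (by grind) (by grind) (by grind)
  have : Q.E b p k l ∨ Q.E b q k l := by grind
  rcases this with h | h
  · exact Q.sq_false_aux h1 h2 hbx hbp hbq h (by grind) (by grind) S0
  · exact Q.sq_false_aux (Q.comm' h1) h2 hbx hbq hbp h (by grind) (by grind)
      (Q.crot (Q.cswap (Q.crot S0)|> Q.crot))

/-- This treats the case where `b` divides the partner of `xx`. Reductions force further square
terms, `rr` and then `bb` with partner `qs`, until none is admissible. -/
theorem sq_false_aux' {x b q r s v w : σ} (h1 : Q.E x x b q) (h2 : Q.E x b r s) (h3 : Q.E x r v w)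
    (hv : v = b ∨ v = q ∨ v = s) (hw : w = b ∨ w = q ∨ w = s) (S0 : Q.C b b q x r s) : False := by
  have S1 : Q.C s v w b b q := Q.crot (Q.crot (Q.csymm (Q.step S0 h3)))
  have S2 := Q.spair h2 h3
  have hrs : r ≠ s := by
    rintro rfl
    obtain ⟨k, l, H⟩ := Q.red S2 r (by grind) (by grind) (by grind)
    grind
  obtain ⟨k, l, H⟩ := Q.red S2 r (by grind) (by grind) (by grind)
  have hrr : Q.E r r k l := by grind
  have S3 := Q.csymm (Q.step (Q.csymm S2) hrr)
  by_cases hsq : s = q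
  · subst hsq
    obtain ⟨rfl, rfl⟩ : v = b ∧ w = b := by
      by_contra hne
      have : v = s ∧ w = s := by grind
      obtain ⟨rfl, rfl⟩ := this
      obtain ⟨k, l, H⟩ := Q.red_sq (Q.crot' S1) (by grind) (by grind)
      grind
    grind
  by_cases hb : v = b ∧ w = b
  · rw [hb.1, hb.2] at S1
    obtain ⟨k, l, H⟩ := Q.red (Q.crot (Q.crot (Q.csymm S1))) b (by grind) (by grind) (by grind)
    grind
  have hbb : Q.E b b q s := by
    by_cases hvb : v = b
    · obtain ⟨k, l, H⟩ := Q.red_sq (Q.crot' (Q.csymm S1)) (by grind) (by grind)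
      grind
    · obtain ⟨k, l, H⟩ := Q.red_sq (Q.crot' (Q.crot' (Q.csymm S1))) (by grind) (by grind)
      grind
  have hqs : ¬ Q.E b s q q := by
    intro h
    obtain ⟨k, l, H⟩ := Q.red (Q.csymm (Q.spair (Q.symm h) (Q.symm hbb))) q
      (by grind) (by grind) (by grind)
    grind
  have S4 := Q.step S1 hbb
  have hcase : (v = b ∧ w = s) ∨ (v = s ∧ w = b) ∨ (v = q ∧ w = q) ∨ (v = s ∧ w = s) := by grind
  rcases hcase with ⟨hv, hw⟩ | ⟨hv, hw⟩ | ⟨hv, hw⟩ | ⟨hv, hw⟩ <;> rw [hv, hw] at S4 h3 S3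
  · obtain ⟨k, l, H⟩ := Q.red (Q.crot S4) q (by grind) (by grind) (by grind)
    grind
  · obtain ⟨k, l, H⟩ := Q.red (Q.crot (Q.crot S4)) q (by grind) (by grind) (by grind)
    grind
  · have hrr' : Q.E r r b s := by grind
    obtain ⟨k, l, H⟩ := Q.red (Q.crot (Q.crot (Q.step (Q.csymm S2) hrr'))) q
      (by grind) (by grind) (by grind)
    grind
  · obtain ⟨k, l, H⟩ := Q.red_sq (Q.crot' S4) (by grind) (by grind)
    grind

/-- If `b ≠ x`, the S-pair at `x` has a forced reduction; the cases are whether `b` divides the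
partner `pq`. -/
theorem eq_of_sq {x b p q r s : σ} (h1 : Q.E x x p q) (h2 : Q.E x b r s) : b = x := by
  by_contra hbx
  have aux : ∀ q r s, Q.E x x b q → Q.E x b r s → False := by
    intro q r s h1 h2
    have S0 := Q.spair h1 h2
    obtain ⟨k, l, H⟩ := Q.red (Q.csymm S0) x (by grind) (by grind) (by grind)
    have : Q.E x r k l ∨ Q.E x s k l := by grind
    rcases this with h | h
    · exact Q.sq_false_aux' h1 h2 h (by grind) (by grind) S0
    · exact Q.sq_false_aux' h1 (Q.comm' h2) h (by grind) (by grind)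
        (by clear * - S0; have := @Q.cswap; have := @Q.crot; have := @Q.csymm; grind only)
  by_cases hp : b = p
  · subst hp; exact aux _ _ _ h1 h2
  by_cases hq : b = q
  · subst hq; exact aux _ _ _ (Q.comm' h1) h2
  exact Q.sq_false_of_ne h1 h2 hbx hp hq

end QuadricSystem

/-! ### Two binomials sharing a variable span a `2 × 3` matrix -/

namespace QuadricSystem

variable {σ : Type*} (Q : QuadricSystem σ)

attribute [grind →] eq_of_sq

/-- Otherwise `bxx ≡ qrs` would reduce with `b` greatest: a term `bx` contradicts `eq_of_sq`, and
`xx` has partner `pq`, where `p` is not available. -/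
theorem eq_of_sq_right {x p q b r s : σ} (h1 : Q.E x x p q) (h2 : Q.E p b r s) : b = q := by
  by_contra hbq
  have hbp : b ≠ p := by grind
  obtain ⟨k, l, H⟩ := Q.red (Q.spair (Q.symm h1) h2) b (by grind) (by grind) (by grind)
  grind

attribute [grind →] eq_of_sq_right

theorem ne_of_ne {x a b p q r s : σ} (h1 : Q.E x a p q) (h2 : Q.E x b r s) (hab : a ≠ b) :
    x ≠ a ∧ x ≠ b ∧ p ≠ q ∧ r ≠ s := by
  refine ⟨?_, ?_, ?_, ?_⟩ <;> grind

/-- The S-pair is `ppq ≡ aaq`. With `p` greatest, `pp` cannot be a term beside `pq`, and the partner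
`xa` of `pq` contains the absent variable `x`. -/
theorem not_E_cross {x a p q : σ} (h1 : Q.E x a p q) (h2 : Q.E x p a q) : False := by
  have := Q.ne_of_ne h1 h2
  obtain ⟨k, l, H⟩ := Q.red_sq (Q.spair h1 h2) (by grind) (by grind)
  grind

/-- Squares are excluded, so if `vw` is not `ar` it is `aq` or `rq`; then `vwq ≡ arq` has no
reduction once `r`, respectively `a`, is greatest. -/
theorem E_cross_of_eq {x a b p q r v w : σ} (h1 : Q.E x a p q) (h2 : Q.E x b r q) (hab : a ≠ b)
    (h3 : Q.E b p v w) (hv : v = a ∨ v = q ∨ v = r) (hw : w = a ∨ w = q ∨ w = r)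
    (S : Q.C v w q a r q) : Q.E b p a r := by
  have n1 := Q.ne_of_ne h1 h2 hab
  have n2 := Q.ne_of_ne (Q.comm h2) h3 (by grind)
  by_contra hne
  by_cases har : a = r
  · subst har
    grind
  · have hvw : (v = a ∧ w = q) ∨ (v = q ∧ w = a) ∨ (v = r ∧ w = q) ∨ (v = q ∧ w = r) := by grind
    rcases hvw with ⟨hv, hw⟩ | ⟨hv, hw⟩ | ⟨hv, hw⟩ | ⟨hv, hw⟩ <;> rw [hv, hw] at S h3
    · obtain ⟨k, l, H⟩ := Q.red (Q.crot (Q.csymm S)) r (by grind) (by grind) (by grind)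
      grind
    · obtain ⟨k, l, H⟩ := Q.red (Q.crot (Q.csymm S)) r (by grind) (by grind) (by grind)
      grind
    · obtain ⟨k, l, H⟩ := Q.red (Q.csymm S) a (by grind) (by grind) (by grind)
      grind
    · obtain ⟨k, l, H⟩ := Q.red (Q.csymm S) a (by grind) (by grind) (by grind)
      grind

theorem E_of_E_mem {a q r s t k l : σ} (hk : k = a ∨ k = r ∨ k = s) (hl : l = a ∨ l = r ∨ l = s)
    (hkl : k ≠ l) (ht : t = a ∨ t = q ∨ t = r ∨ t = s) (h : Q.E q t k l) (hrs : ¬ Q.E q a r s)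
    (hqq : q ≠ t) :
    (t = r ∧ Q.E q r a s) ∨ (t = s ∧ Q.E q s a r) := by
  have n := Q.ne_all h
  have h' := Q.comm' h
  rcases hk with rfl | rfl | rfl <;> rcases hl with rfl | rfl | rfl <;> 
    rcases ht with rfl | rfl | rfl | rfl <;> simp_all

/-- Substituting `as` for `qr` gives `asw ≡ ars`. With `r` greatest, the reduction this requires is
barred by uniqueness or by `not_E_cross`. -/
theorem E_cross_false {x a b p q r s w : σ} (h1 : Q.E x a p q) (h2 : Q.E x b r s) (hab : a ≠ b)
    (h3 : Q.E b p r w) (hw : w = a ∨ w = q ∨ w = r ∨ w = s) (S : Q.C r w q a r s)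
    (hE : Q.E q r a s) : False := by
  have n1 := Q.ne_of_ne h1 h2 hab
  have n2 := Q.ne_of_ne (Q.comm h2) h3 (by grind)
  have hx := fun h => Q.not_E_cross (Q.comm hE) h
  have S1 := Q.csymm (Q.step (Q.csymm (Q.crot (Q.crot S))) hE)
  obtain ⟨k, l, H⟩ := Q.red (Q.crot (Q.csymm S1)) r (by grind) (by grind) (by grind)
  grind

theorem E_cross_aux {x a b p q r s v w : σ} (h1 : Q.E x a p q) (h2 : Q.E x b r s) (hab : a ≠ b)
    (h3 : Q.E b p v w) (hv : v = a ∨ v = q ∨ v = r ∨ v = s)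
    (hw : w = a ∨ w = q ∨ w = r ∨ w = s) (S : Q.C v w q a r s) :
    (q = s ∧ Q.E b p a r) ∨ (q = r ∧ Q.E b p a s) := by
  have Sr := Q.cswap' (Q.crot' (Q.crot' S))
  by_cases hq : q = s
  · subst hq
    exact .inl ⟨rfl, Q.E_cross_of_eq h1 h2 hab h3 (by grind) (by grind) S⟩
  by_cases hq' : q = r
  · subst hq'
    exact .inr ⟨rfl, Q.E_cross_of_eq h1 (Q.comm' h2) hab h3 (by grind) (by grind) Sr⟩
  exfalso
  have n1 := Q.ne_of_ne h1 h2 hab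
  have n2 := Q.ne_of_ne (Q.comm h2) h3 (by grind)
  -- Now `q` divides the left side `vwq` but not `ars`, so `q` may be made greatest.
  obtain ⟨k, l, hk, hl, hk', hl', H⟩ := Q.red (Q.crot (Q.crot S)) q (by grind) (by grind) (by grind)
  have hk1 : k = a ∨ k = r ∨ k = s := by grind only
  have hl1 : l = a ∨ l = r ∨ l = s := by grind only
  have m1 := Q.ne_all h1
  have m2 := Q.ne_all h2
  have hnot : ¬ Q.E q a r s := by
    intro h
    rcases Q.uniq (Q.symm h) (Q.symm h2) with h | h
    · exact m1.2.1 h.1.symm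
    · exact n1.1 h.2.symm
  have hsq : ∀ k l, ¬ Q.E q q k l := fun k l h =>
    n1.2.2.1 (Q.eq_of_sq h (Q.comm (Q.symm h1)))
  have H1 : Q.E q v k l ∨ Q.E q w k l := by
    rcases H with H | H | ⟨H, -⟩
    · exact .inl H
    · exact .inr H
    · exfalso
      rcases Q.uniq H (Q.symm h3) with h | h
      · rcases hk1 with h' | h' | h'
        · exact hab (h'.symm.trans h.1)
        · exact m2.2.2.1 (h.1.symm.trans h')
        · exact m2.2.2.2 (h.1.symm.trans h')
      · rcases hl1 with h' | h' | h'
        · exact hab (h'.symm.trans h.2)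
        · exact m2.2.2.1 (h.2.symm.trans h')
        · exact m2.2.2.2 (h.2.symm.trans h')
  have hkl : k ≠ l := by
    rintro rfl
    have : ∀ t, ¬ Q.E q t k k := by
      intro t h
      obtain rfl := Q.eq_of_sq_right (Q.symm h) (Q.comm (Q.symm h1))
      rcases Q.uniq (Q.comm h) (Q.symm h1) with h | h
      · exact n1.1 (h.1.symm.trans h.2)
      · exact n1.1 (h.2.symm.trans h.1)
    exact H1.elim (this v) (this w)
  rcases H1 with H1 | H1
  · obtain ⟨rfl, hE⟩ | ⟨rfl, hE⟩ := Q.E_of_E_mem hk1 hl1 hkl hv H1 hnot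
      (fun h => hsq k l (by rw [← h] at H1; exact H1))
    · exact Q.E_cross_false h1 h2 hab h3 hw S hE
    · exact Q.E_cross_false h1 (Q.comm' h2) hab h3 (by rcases hw with h | h | h | h <;> simp [h])
        Sr hE
  · obtain ⟨rfl, hE⟩ | ⟨rfl, hE⟩ := Q.E_of_E_mem hk1 hl1 hkl hw H1 hnot
      (fun h => hsq k l (by rw [← h] at H1; exact H1))
    · exact Q.E_cross_false h1 h2 hab (Q.comm' h3) hv (Q.cswap S) hE
    · exact Q.E_cross_false h1 (Q.comm' h2) hab (Q.comm' h3)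
        (by rcases hv with h | h | h | h <;> simp [h]) (Q.cswap Sr) hE

/-- The S-pair `bpq ≡ ars` must reduce with `b` greatest, hence through `bp` or `bq`. Replacing that
term and reducing once more forces a common variable of `pq` and `rs`. The four alternatives only
differ by exchanging `p` with `q` and `r` with `s`. -/
theorem E_cross {x a b p q r s : σ} (h1 : Q.E x a p q) (h2 : Q.E x b r s) (hab : a ≠ b) :
    (q = s ∧ Q.E b p a r) ∨ (q = r ∧ Q.E b p a s) ∨ (p = s ∧ Q.E b q a r) ∨
      (p = r ∧ Q.E b q a s) := by
  have n1 := Q.ne_of_ne h1 h2 hab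
  have S := Q.spair h1 h2
  -- Reduction through `pq` is impossible: its partner `xa` contains `x`, which is absent from `bpq
  -- ≡ ars`.
  obtain ⟨k, l, H⟩ := Q.red S b (by grind) (by grind) (by grind)
  have : Q.E b p k l ∨ Q.E b q k l := by grind
  rcases this with h | h
  · have := Q.E_cross_aux h1 h2 hab h (by grind) (by grind) (Q.csymm (Q.step (Q.csymm S) h))
    grind
  · have := Q.E_cross_aux (Q.comm' h1) h2 hab h (by grind) (by grind) 
      (Q.csymm (Q.step (Q.csymm (Q.crot (Q.crot (Q.cswap (Q.crot S))))) h))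
    grind
end QuadricSystem

/-! ### Columns of the matrix through a fixed corner -/

namespace QuadricSystem

variable {σ : Type*} (Q : QuadricSystem σ)

theorem E_minor {x a b p q r : σ} (h1 : Q.E x a p q) (h2 : Q.E x b r q) (hab : a ≠ b) :
    Q.E b p a r := by
  have n1 := Q.ne_of_ne h1 h2 hab
  have hpr : p ≠ r := by
    rintro rfl
    have := Q.uniq (Q.symm h1) (Q.symm h2)
    grind
  rcases Q.E_cross h1 h2 hab with h | h | h | h
  · exact h.2
  all_goals grind

/-- By `E_cross`, the partner `st` meets both `pq` and `rq`. If it avoids `q` it equals `pr`; then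
the minor relations give `ar` the two partners `bp` and `cq`, against uniqueness. -/
theorem eq_or_eq_of_E {x a b c p q r s t : σ} (h1 : Q.E x a p q) (h2 : Q.E x b r q) (hab : a ≠ b)
    (h3 : Q.E x c s t) : s = q ∨ t = q := by
  have n1 := Q.ne_of_ne h1 h2 hab
  have m1 := Q.ne_all h2
  by_cases hca : c = a
  · subst hca
    rcases Q.uniq h1 h3 with h | h <;> simp [h]
  by_cases hcb : c = b
  · subst hcb
    rcases Q.uniq h2 h3 with h | h <;> simp [h]
  by_contra! hne
  have aux : ∀ {s t}, Q.E x c s t → s = p → t = r → False := by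
    rintro s t h3 rfl rfl
    have e1 := Q.E_minor h1 h2 hab
    have e2 := Q.E_minor (Q.comm' h1) (Q.comm' h3) (Ne.symm hca)
    rcases Q.uniq (Q.symm e1) (Q.symm e2) with h | h
    · exact hcb h.1.symm
    · exact m1.2.2.2 h.1
  have hpr : p ≠ r := by
    rintro rfl
    rcases Q.uniq (Q.symm (Q.comm' h1)) (Q.symm (Q.comm' h2)) with h | h
    · exact hab h.2
    · exact n1.1 h.2.symm
  have c1 := Q.E_cross h1 h3 (Ne.symm hca)
  have c2 := Q.E_cross h2 h3 (Ne.symm hcb)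
  have : (s = p ∧ t = r) ∨ (t = p ∧ s = r) := by
    have c1' : p = s ∨ p = t := by tauto
    have c2' : r = s ∨ r = t := by tauto
    rcases c1' with rfl | rfl <;> rcases c2' with rfl | rfl <;> simp_all
  rcases this with h | h
  · exact aux h3 h.1 h.2
  · exact aux (Q.comm' h3) h.1 h.2

/-- `(y, z)` is a column of the matrix with corner column `(x, q)`. -/
def IsColumn (x q y z : σ) : Prop := (y = x ∧ z = q) ∨ Q.E x z y q

variable {Q} {x a b p q r : σ}

theorem IsColumn.swap {y z : σ} (h : Q.IsColumn x q y z) : Q.IsColumn q x z y := by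
  rcases h with ⟨rfl, rfl⟩ | h
  · exact .inl ⟨rfl, rfl⟩
  · exact .inr (Q.comm (Q.comm' (Q.symm h)))

theorem IsColumn.eq_iff {y z y' z' : σ} (hc : Q.IsColumn x q y z) (hd : Q.IsColumn x q y' z')
    (hz : z = z') : y = y' := by
  subst hz
  rcases hc with ⟨rfl, rfl⟩ | hc <;> rcases hd with ⟨rfl, h⟩ | hd
  · rfl
  · exact ((Q.ne_all hd).2.2.2 rfl).elim
  · exact ((Q.ne_all hc).2.2.2 h).elim
  · rcases Q.uniq hc hd with h | h
    · exact h.1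
    · exact h.1.trans h.2

theorem IsColumn.E {y z y' z' : σ} (hc : Q.IsColumn x q y z) (hd : Q.IsColumn x q y' z')
    (hne : z ≠ z') : Q.E y z' y' z := by
  rcases hc with ⟨rfl, rfl⟩ | hc
  · rcases hd with ⟨rfl, rfl⟩ | hd
    · exact (hne rfl).elim
    · exact hd
  · rcases hd with ⟨rfl, rfl⟩ | hd
    · exact Q.symm hc
    · exact Q.comm' (Q.comm (Q.E_minor hc hd hne))

/-- Any column can play the role of the corner, which makes the facts about `x` available for every
first-row entry. -/
theorem IsColumn.exists_pair (h1 : Q.E x a p q) (h2 : Q.E x b r q) (hab : a ≠ b) {y z : σ}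
    (hc : Q.IsColumn x q y z) :
    ∃ a b p r, a ≠ b ∧ Q.E y a p z ∧ Q.E y b r z := by
  rcases hc with ⟨rfl, rfl⟩ | hc
  · exact ⟨a, b, p, r, hab, h1, h2⟩
  · obtain ⟨t, s, htz, ht⟩ : ∃ t s, z ≠ t ∧ Q.E x t s q := by
      by_cases hz : z = a
      · exact ⟨b, r, hz ▸ hab, h2⟩
      · exact ⟨a, p, hz, h1⟩
    exact ⟨q, t, x, s, ((Q.ne_all ht).2.2.2).symm, Q.symm hc,
      Q.comm' (Q.comm (Q.E_minor hc ht htz))⟩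

/-- A binomial meeting the matrix is one of its minors: its partner contains `z` by `eq_or_eq_of_E`,
and `E_minor` turns the rest into a column. -/
theorem IsColumn.exists_of_E_fst (h1 : Q.E x a p q) (h2 : Q.E x b r q) (hab : a ≠ b) {y z : σ}
    (hc : Q.IsColumn x q y z) {j k l : σ} (h : Q.E y j k l) :
    ∃ d, Q.IsColumn x q d j ∧ ((k = d ∧ l = z) ∨ (l = d ∧ k = z)) := by
  have aux : ∀ {k}, Q.E y j k z → Q.IsColumn x q k j := by
    intro k h
    rcases hc with ⟨rfl, rfl⟩ | hc
    · exact .inr h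
    · by_cases hj : j = q
      · subst hj
        left
        rcases Q.uniq h (Q.symm hc) with h' | h'
        · exact ⟨h'.1, rfl⟩
        · exact ⟨h'.1.trans h'.2, rfl⟩
      · exact .inr (Q.comm' (Q.comm (Q.E_minor (Q.symm hc) h (Ne.symm hj))))
  obtain ⟨a', b', p', r', hab', h1', h2'⟩ := hc.exists_pair h1 h2 hab
  rcases Q.eq_or_eq_of_E h1' h2' hab' h with rfl | rfl
  · exact ⟨l, aux (Q.comm' h), .inr ⟨rfl, rfl⟩⟩
  · exact ⟨k, aux h, .inl ⟨rfl, rfl⟩⟩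

theorem IsColumn.exists_of_E_snd (h1 : Q.E x a p q) (h2 : Q.E x b r q) (hab : a ≠ b) {y z : σ}
    (hc : Q.IsColumn x q y z) {j k l : σ} (h : Q.E z j k l) :
    ∃ d, Q.IsColumn x q j d ∧ ((k = d ∧ l = y) ∨ (l = d ∧ k = y)) := by
  have hpr : p ≠ r := by
    rintro rfl
    rcases Q.uniq (Q.symm (Q.comm' h1)) (Q.symm (Q.comm' h2)) with h | h
    · exact hab h.2
    · exact (Q.ne_of_ne h1 h2 hab).1 h.2.symm
  obtain ⟨d, hd, H⟩ := hc.swap.exists_of_E_fst (Q.comm (Q.comm' (Q.symm h1)))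
    (Q.comm (Q.comm' (Q.symm h2))) hpr h
  exact ⟨d, hd.swap, H⟩

end QuadricSystem

open scoped MonomialOrder

/-! ### Gröbner bases and minimal generation in one degree -/

section Groebner

variable {σ : Type u} {k : Type v} [Field k] {m : MonomialOrder.{u, u} σ}
  {F : Set (MvPolynomial σ k)}

theorem isGroebnerBasis_iff :
    IsGroebnerBasis m F ↔
      ∀ f ∈ Ideal.span F, f ≠ 0 → ∃ g ∈ F, g ≠ 0 ∧ m.degree g ≤ m.degree f := by
  have key : ∀ B : Set (MvPolynomial σ k), Ideal.span (m.leadingTerm '' B) =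
      Ideal.span ((fun s => MvPolynomial.monomial s (1 : k)) '' (m.degree '' (B \ {0}))) := by
    intro B
    rw [MonomialOrder.span_leadingTerm_eq_span_monomial', Set.image_image]
  constructor
  · intro h f hf hf0
    have : m.leadingTerm f ∈ Ideal.span (m.leadingTerm '' F) := by
      rw [← h]
      exact Ideal.subset_span ⟨f, hf, rfl⟩
    rw [key, MvPolynomial.mem_ideal_span_monomial_image] at this
    obtain ⟨_, ⟨g, ⟨hg, hg0⟩, rfl⟩, hle⟩ := this (m.degree f) (by
      rw [m.support_leadingTerm' hf0]; simp)
    exact ⟨g, hg, hg0, hle⟩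
  · intro h
    refine le_antisymm ?_ (Ideal.span_mono (Set.image_mono Ideal.subset_span))
    rw [Ideal.span_le]
    rintro _ ⟨f, hf, rfl⟩
    by_cases hf0 : f = 0
    · simp [hf0]
    rw [SetLike.mem_coe, key, MvPolynomial.mem_ideal_span_monomial_image]
    intro s hs
    rw [m.support_leadingTerm' hf0, Finset.mem_singleton] at hs
    obtain ⟨g, hg, hg0, hle⟩ := h f hf hf0
    exact ⟨_, ⟨g, ⟨hg, hg0⟩, rfl⟩, hs ▸ hle⟩

theorem eq_of_le_of_degree_eq {u v : σ →₀ ℕ} (h : u ≤ v) (hd : u.degree = v.degree) : u = v := by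
  obtain ⟨w, rfl⟩ := exists_add_of_le h
  have : w.degree = 0 := by simpa using hd
  rw [Finsupp.degree_eq_zero_iff] at this
  simp [this]

theorem degree_degree {f : MvPolynomial σ k} {n : ℕ} (hf : f.IsHomogeneous n) (h0 : f ≠ 0) :
    (m.degree f).degree = n := by
  have := hf (m.coeff_degree_ne_zero_iff.2 h0)
  rw [Finsupp.degree_eq_weight_one]
  exact this

/-- A multiple of `g` cancelling the leading term of `f`. -/
theorem exists_smul_cancel {f g : MvPolynomial σ k} (h0 : g ≠ 0) (hd : m.degree f = m.degree g)
    (hne : m.degree f ≠ 0) :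
    ∃ c : k, f - MvPolynomial.C c * g = 0 ∨ m.degree (f - MvPolynomial.C c * g) ≺[m] m.degree f := by
  refine ⟨m.leadingCoeff f / m.leadingCoeff g, or_iff_not_imp_left.2 fun h => ?_⟩
  have hg := m.leadingCoeff_ne_zero_iff.2 h0
  have h' := MonomialOrder.degree_reduce_lt (m := m) (f := f) (b := g) hg.isUnit hd.ge hne
  have heq : f - MvPolynomial.C (m.leadingCoeff f / m.leadingCoeff g) * g =
      m.reduce hg.isUnit f := by
    rw [MonomialOrder.reduce, hd, tsub_self, MvPolynomial.C_apply, div_eq_inv_mul]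
    simp
  rw [heq]
  exact h'

/-- If `f` and `g` had the same leading monomial, cancelling it would leave an element generated by
members of `F` with smaller leading monomials, so `f` would be redundant. -/
theorem degree_ne_of_isGroebnerBasis (hF : IsGroebnerBasis m F) (hmin : IsMinimalGeneratingSet F)
    {n : ℕ} (hn : n ≠ 0) (hhom : ∀ f ∈ F, f.IsHomogeneous n) {f g : MvPolynomial σ k} (hf : f ∈ F)
    (hg : g ∈ F) (hfg : f ≠ g) : m.degree f ≠ m.degree g := by
  intro hd
  have h0 : ∀ f ∈ F, f ≠ 0 := by
    rintro f hf rfl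
    exact hmin _ hf (zero_mem _)
  have hne : ∀ f : MvPolynomial σ k, f.IsHomogeneous n → f ≠ 0 → m.degree f ≠ 0 := by
    intro f hf hf0 h
    have := degree_degree (m := m) hf hf0
    rw [h] at this
    exact hn (by simpa using this.symm)
  -- In degree `n` divisibility of leading monomials is equality, so each division step subtracts a
  -- constant multiple of a generator whose leading monomial is below that of `f`.
  have claim : ∀ s : m.syn, ∀ h ∈ Ideal.span F, h.IsHomogeneous n → m.toSyn (m.degree h) = s →
      (h = 0 ∨ m.degree h ≺[m] m.degree f) →
      h ∈ Ideal.span {g ∈ F | m.degree g ≺[m] m.degree f} := by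
    intro s
    induction s using WellFoundedLT.induction with
    | ind s ih =>
      intro h hI hh hs hlt
      by_cases hh0 : h = 0
      · simp [hh0]
      obtain ⟨p, hp, hp0, hle⟩ := isGroebnerBasis_iff.1 hF h hI hh0
      have heq := eq_of_le_of_degree_eq hle (by
        rw [degree_degree (hhom p hp) hp0, degree_degree hh hh0])
      obtain ⟨c, hc⟩ := exists_smul_cancel hp0 heq.symm (hne h hh hh0)
      have hlt := hlt.resolve_left hh0
      have hmem : h - MvPolynomial.C c * p ∈ Ideal.span {g ∈ F | m.degree g ≺[m] m.degree f} := by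
        rcases hc with hc | hc
        · simp [hc]
        · refine ih _ (hs ▸ hc) _ (sub_mem hI (Ideal.mul_mem_left _ _ (Ideal.subset_span hp)))
            (hh.sub ((hhom p hp).C_mul c)) rfl (.inr (hc.trans hlt))
      rw [← sub_add_cancel h (MvPolynomial.C c * p)]
      exact add_mem hmem (Ideal.mul_mem_left _ _ (Ideal.subset_span ⟨hp, heq ▸ hlt⟩))
  obtain ⟨c, hc⟩ := exists_smul_cancel (h0 g hg) hd (hne f (hhom f hf) (h0 f hf))
  have hmem := claim _ (f - MvPolynomial.C c * g)
    (sub_mem (Ideal.subset_span hf) (Ideal.mul_mem_left _ _ (Ideal.subset_span hg)))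
    ((hhom f hf).sub ((hhom g hg).C_mul c)) rfl hc
  refine hmin f hf ?_
  suffices h : f - MvPolynomial.C c * g + MvPolynomial.C c * g ∈ Ideal.span (F \ {f}) by
    rwa [sub_add_cancel] at h
  refine add_mem (Ideal.span_mono ?_ hmem)
    (Ideal.mul_mem_left _ _ (Ideal.subset_span ⟨hg, fun h => hfg h.symm⟩))
  rintro p ⟨hp, hlt⟩
  refine ⟨hp, ?_⟩
  rintro rfl
  exact lt_irrefl _ hlt

end Groebner

open MvPolynomial

/-! ### Binomial edges and congruence of monomials -/

section Congruence

variable {σ : Type u} {k : Type v} [Field k]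

/-- `u` and `v` are the two exponents of some binomial in `F`. -/
def IsBinomialEdge (F : Set (MvPolynomial σ k)) (u v : σ →₀ ℕ) : Prop :=
  u ≠ v ∧ ∃ f ∈ F, (f.support : Set (σ →₀ ℕ)) = {u, v}

/-- The monomials with exponents `u` and `v` agree modulo `I` up to a unit of `k`. -/
def MonomialCongr (I : Ideal (MvPolynomial σ k)) (u v : σ →₀ ℕ) : Prop :=
  ∃ c : k, c ≠ 0 ∧ monomial u 1 - monomial v c ∈ I

variable {F : Set (MvPolynomial σ k)} {I : Ideal (MvPolynomial σ k)} {u v w : σ →₀ ℕ}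

theorem IsBinomialEdge.symm (h : IsBinomialEdge F u v) : IsBinomialEdge F v u := by
  obtain ⟨hne, f, hf, hs⟩ := h
  exact ⟨hne.symm, f, hf, by rw [hs, Set.pair_comm]⟩

theorem exists_isBinomialEdge {f : MvPolynomial σ k} (hf : f ∈ F) (h2 : f.support.card = 2) :
    ∃ u v, u ≠ v ∧ (f.support : Set (σ →₀ ℕ)) = {u, v} ∧ IsBinomialEdge F u v := by
  classical
  obtain ⟨u, v, hne, hs⟩ := Finset.card_eq_two.1 h2
  have : (f.support : Set (σ →₀ ℕ)) = {u, v} := by rw [hs]; simp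
  exact ⟨u, v, hne, this, hne, f, hf, this⟩

theorem eq_monomial_add_monomial {f : MvPolynomial σ k} (hne : u ≠ v)
    (hs : (f.support : Set (σ →₀ ℕ)) = {u, v}) :
    f = monomial u (f.coeff u) + monomial v (f.coeff v) := by
  classical
  have hs' : f.support = {u, v} := by
    apply Finset.coe_injective; rw [hs]; simp
  conv_lhs => rw [f.as_sum, hs', Finset.sum_pair hne]

theorem mem_support_of_pair {f : MvPolynomial σ k}
    (hs : (f.support : Set (σ →₀ ℕ)) = {u, v}) : f.coeff u ≠ 0 ∧ f.coeff v ≠ 0 := by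
  have h1 : u ∈ (f.support : Set (σ →₀ ℕ)) := by rw [hs]; simp
  have h2 : v ∈ (f.support : Set (σ →₀ ℕ)) := by rw [hs]; simp
  exact ⟨by simpa using h1, by simpa using h2⟩

namespace MonomialCongr

theorem refl (u : σ →₀ ℕ) : MonomialCongr I u u := ⟨1, one_ne_zero, by simp⟩

theorem symm (h : MonomialCongr I u v) : MonomialCongr I v u := by
  obtain ⟨c, hc, h⟩ := h
  refine ⟨c⁻¹, inv_ne_zero hc, ?_⟩
  have := I.mul_mem_left (C (-c⁻¹)) h
  simpa [mul_sub, C_mul_monomial, hc, neg_add_eq_sub] using this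

theorem trans (h : MonomialCongr I u v) (h' : MonomialCongr I v w) : MonomialCongr I u w := by
  obtain ⟨c, hc, h⟩ := h
  obtain ⟨d, hd, h'⟩ := h'
  refine ⟨c * d, mul_ne_zero hc hd, ?_⟩
  have := I.add_mem h (I.mul_mem_left (C c) h')
  simpa [mul_sub, C_mul_monomial] using this

theorem add_right (h : MonomialCongr I u v) (w : σ →₀ ℕ) : MonomialCongr I (u + w) (v + w) := by
  obtain ⟨c, hc, h⟩ := h
  refine ⟨c, hc, ?_⟩
  have := I.mul_mem_right (monomial w 1) h
  simpa [sub_mul, monomial_mul] using this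

theorem of_isBinomialEdge (h : IsBinomialEdge F u v) : MonomialCongr (Ideal.span F) u v := by
  obtain ⟨hne, f, hf, hs⟩ := h
  obtain ⟨h1, h2⟩ := mem_support_of_pair hs
  refine ⟨-(f.coeff v / f.coeff u), by simp [h1, h2], ?_⟩
  have := (Ideal.span F).mul_mem_left (C (f.coeff u)⁻¹) (Ideal.subset_span hf)
  have heq := eq_monomial_add_monomial hne hs
  generalize coeff u f = a at *
  generalize coeff v f = b at *
  rw [heq] at this
  simpa [mul_add, C_mul_monomial, h1, div_eq_inv_mul] using this

end MonomialCongr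

end Congruence

/-! ### Lexicographic robustness yields the combinatorial model -/

/-- Sets of quadratic binomials as in the theorem, that are Gröbner bases for all lexicographic
orders. -/
structure IsRobustQuadratic {σ : Type u} [Finite σ] {k : Type v} [Field k]
    (F : Set (MvPolynomial σ k)) : Prop where
  bin : ∀ f ∈ F, IsQuadraticBinomial f
  prime : ∀ f ∈ F, Prime f
  nonsq : ∀ f ∈ F, ∀ (i j : σ) (a b : k), f ≠ C a * X i ^ 2 + C b * X j ^ 2
  min : IsMinimalGeneratingSet F
  lex : ∀ _ : LinearOrder σ, IsGroebnerBasis MonomialOrder.lex F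

section BinomialFacts

variable {σ : Type u} {k : Type v} [Field k] {F : Set (MvPolynomial σ k)}

/-- A variable common to both terms would divide the prime `f`, hence be associated to it, although
the degrees are 1 and 2. -/
theorem IsBinomialEdge.coprime (hprime : ∀ f ∈ F, Prime f) (hbin : ∀ f ∈ F, IsQuadraticBinomial f)
    {u v : σ →₀ ℕ} (h : IsBinomialEdge F u v) (i : σ) : u i = 0 ∨ v i = 0 := by
  obtain ⟨hne, f, hf, hs⟩ := h
  by_contra! hi
  have hX : (X i : MvPolynomial σ k) ∣ f := by
    rw [eq_monomial_add_monomial hne hs]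
    exact dvd_add (X_dvd_monomial.2 (.inr hi.1)) (X_dvd_monomial.2 (.inr hi.2))
  have hass : Associated (X i) f :=
    ((X_prime (R := k)).irreducible.dvd_irreducible_iff_associated (hprime f hf).irreducible).1 hX
  have h2 := (hbin f hf).1.totalDegree (hprime f hf).ne_zero
  obtain ⟨c, hc⟩ := hass
  obtain ⟨r, hr, hcr⟩ := isUnit_iff_eq_C_of_isReduced.1 c.isUnit
  rw [← hc, hcr] at h2
  have := totalDegree_mul (X i : MvPolynomial σ k) (C r)
  simp only [totalDegree_X, totalDegree_C] at this
  omega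

theorem degree_of_isBinomialEdge (hbin : ∀ f ∈ F, IsQuadraticBinomial f) {u v : σ →₀ ℕ}
    (h : IsBinomialEdge F u v) : u.degree = 2 := by
  obtain ⟨hne, f, hf, hs⟩ := h
  have := (hbin f hf).1 (mem_support_of_pair hs).1
  rw [Finsupp.degree_eq_weight_one]
  exact this

theorem exists_eq_single_add_single {u : σ →₀ ℕ} (h : u.degree = 2) :
    ∃ i j, u = Finsupp.single i 1 + Finsupp.single j 1 := by
  have step : ∀ (u : σ →₀ ℕ) (n : ℕ), u.degree = n + 1 →
      ∃ i w, u = Finsupp.single i 1 + w ∧ w.degree = n := by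
    intro u n hu
    have h0 : u ≠ 0 := by rintro rfl; simp at hu
    obtain ⟨i, hi⟩ := Finsupp.ne_iff.1 h0
    have hle : Finsupp.single i 1 ≤ u := by
      rw [Finsupp.single_le_iff]
      exact Nat.one_le_iff_ne_zero.2 hi
    obtain ⟨w, rfl⟩ := exists_add_of_le hle
    refine ⟨i, w, rfl, ?_⟩
    simp only [map_add, Finsupp.degree_single] at hu
    omega
  obtain ⟨i, w, rfl, hw⟩ := step u 1 h
  obtain ⟨j, w, rfl, hw'⟩ := step w 0 hw
  rw [Finsupp.degree_eq_zero_iff] at hw'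
  exact ⟨i, j, by simp [hw']⟩

/-- For `MonomialOrder.lex` the smaller index is compared first, so a smaller key means a greater
variable. The enumeration `e` breaks ties. -/
theorem exists_linearOrder [Finite σ] (key : σ → ℕ) :
    ∃ _ : LinearOrder σ, ∀ i j, key i < key j → i < j := by
  obtain ⟨n, ⟨e⟩⟩ := Finite.exists_equiv_fin σ
  have hinj : Function.Injective fun i => toLex (key i, e i) := by
    intro i j h
    simpa using congrArg (fun x => (ofLex x).2) h
  refine ⟨LinearOrder.lift' (fun i => toLex (key i, e i)) hinj, fun i j h => ?_⟩
  change toLex (key i, e i) < toLex (key j, e j)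
  exact Prod.Lex.toLex_lt_toLex.2 (.inl h)

end BinomialFacts

namespace IsRobustQuadratic

variable {σ : Type u} [Finite σ] {k : Type v} [Field k] {F : Set (MvPolynomial σ k)}

theorem degree_ne (hF : IsRobustQuadratic F) [LinearOrder σ] {f g : MvPolynomial σ k}
    (hf : f ∈ F) (hg : g ∈ F) (h : f ≠ g) :
    MonomialOrder.lex.degree f ≠ MonomialOrder.lex.degree g :=
  degree_ne_of_isGroebnerBasis (hF.lex _) hF.min two_ne_zero (fun f hf => (hF.bin f hf).1) hf hg h

theorem exists_edge_le_degree (hF : IsRobustQuadratic F) [LinearOrder σ] {f : MvPolynomial σ k}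
    (hf : f ∈ Ideal.span F) (h0 : f ≠ 0) :
    ∃ e e', IsBinomialEdge F e e' ∧ e ≤ MonomialOrder.lex.degree f ∧
      e' ≺[MonomialOrder.lex] e := by
  obtain ⟨g, hg, hg0, hle⟩ := isGroebnerBasis_iff.1 (hF.lex _) f hf h0
  obtain ⟨a, b, hne, hs, hE⟩ := exists_isBinomialEdge hg (hF.bin g hg).2
  have hmem : MonomialOrder.lex.degree g ∈ (g.support : Set (σ →₀ ℕ)) :=
    MonomialOrder.degree_mem_support hg0
  have hlt : ∀ w ∈ (g.support : Set (σ →₀ ℕ)), w ≠ MonomialOrder.lex.degree g →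
      w ≺[MonomialOrder.lex] MonomialOrder.lex.degree g := fun w hw hne =>
    lt_of_le_of_ne (MonomialOrder.le_degree hw) fun h =>
      hne ((MonomialOrder.lex (σ := σ)).toSyn.injective h)
  rw [hs] at hmem hlt
  rcases hmem with h | h
  · rw [h] at hlt hle
    exact ⟨a, b, hE, hle, hlt b (by simp) hne.symm⟩
  · rw [Set.mem_singleton_iff.1 h] at hlt hle
    exact ⟨b, a, hE.symm, hle, hlt a (by simp) hne⟩

/-- Reducing a monomial by a binomial gives a nonzero multiple of a smaller monomial, so membership
would start an infinite descent. -/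
theorem monomial_notMem (hF : IsRobustQuadratic F) (u : σ →₀ ℕ) {c : k} (hc : c ≠ 0) :
    monomial u c ∉ Ideal.span F := by
  classical
  obtain ⟨_, -⟩ := exists_linearOrder (σ := σ) fun _ => 0
  have key : ∀ s : (MonomialOrder.lex (σ := σ)).syn, ∀ u : σ →₀ ℕ, ∀ c : k, c ≠ 0 →
      MonomialOrder.lex.toSyn u = s → monomial u c ∉ Ideal.span F := by
    intro s
    induction s using WellFoundedLT.induction with
    | ind s ih =>
      intro u c hc hs h
      obtain ⟨e, e', hE, hle, hlt⟩ := hF.exists_edge_le_degree h (by simpa using hc)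
      rw [MonomialOrder.degree_monomial, if_neg hc] at hle
      obtain ⟨w, rfl⟩ := exists_add_of_le hle
      obtain ⟨d, hd, h'⟩ := (MonomialCongr.of_isBinomialEdge hE).add_right w
      refine ih _ ?_ (e' + w) (c * d) (mul_ne_zero hc hd) rfl ?_
      · rw [← hs, map_add, map_add]
        exact add_lt_add_left hlt _
      · have := sub_mem h (Ideal.mul_mem_left _ (C c) h')
        simpa [mul_sub, C_mul_monomial] using this
  exact key _ u c hc rfl

theorem exists_edge_le (hF : IsRobustQuadratic F) [LinearOrder σ] {u v : σ →₀ ℕ}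
    (h : MonomialCongr (Ideal.span F) u v) (hlt : v ≺[MonomialOrder.lex] u) :
    ∃ e e', IsBinomialEdge F e e' ∧ e ≤ u ∧ e' ≺[MonomialOrder.lex] e := by
  classical
  obtain ⟨c, hc, h⟩ := h
  have hdeg : (MonomialOrder.lex (σ := σ)).degree (monomial u (1 : k) - monomial v c) = u := by
    rw [MonomialOrder.degree_sub_of_lt, MonomialOrder.degree_monomial, if_neg one_ne_zero]
    rwa [MonomialOrder.degree_monomial, if_neg hc, MonomialOrder.degree_monomial,
      if_neg one_ne_zero]
  have h0 : monomial u (1 : k) - monomial v c ≠ 0 := by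
    intro h0
    have := congrArg (coeff u) h0
    have hne : v ≠ u := by rintro rfl; exact lt_irrefl _ hlt
    simp [coeff_monomial, hne] at this
  have := hF.exists_edge_le_degree h h0
  rwa [hdeg] at this

theorem exists_edge_of_congr (hF : IsRobustQuadratic F) {u v : σ →₀ ℕ}
    (h : MonomialCongr (Ideal.span F) u v) (y z : σ) (hy : v y < u y) :
    ∃ e e', IsBinomialEdge F e e' ∧ e ≤ u ∧ (∀ i, e' i ≠ 0 → u i ≠ 0 ∨ v i ≠ 0) ∧ e' y ≤ e y ∧
      (e' y < e y ∨ e' z ≤ e z) := by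
  classical
  -- Absent variables are put first so that the lex-smaller exponent `e'` cannot contain them; then
  -- `y`, then `z`.
  obtain ⟨_, hord⟩ := exists_linearOrder (σ := σ) fun i =>
    if u i = 0 ∧ v i = 0 then 0 else if i = y then 1 else if i = z then 2 else 3
  have hlt : v ≺[MonomialOrder.lex] u := by
    rw [MonomialOrder.lex_lt_iff]
    by_contra hle
    rcases (not_lt.1 hle).lt_or_eq with hlt | heq
    · obtain ⟨i, hi, hlt⟩ := Finsupp.Lex.lt_iff.1 hlt
      simp only [ofLex_toLex] at hi hlt
      have : y < i := hord y i (by grind)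
      have := hi y this
      omega
    · rw [toLex_inj] at heq
      subst heq
      exact lt_irrefl _ hy
  obtain ⟨e, e', hE, hle, hlt'⟩ := hF.exists_edge_le h hlt
  refine ⟨e, e', hE, hle, ?_⟩
  obtain ⟨i, hi, hlti⟩ := Finsupp.Lex.lt_iff.1 (MonomialOrder.lex_lt_iff.1 hlt')
  simp only [ofLex_toLex] at hi hlti
  have hui : u i ≠ 0 := by have := hle i; omega
  have h0 : ∀ j, u j = 0 → v j = 0 → e' j = 0 := by
    intro j hj hj'
    have := hi j (hord j i (by grind))
    have := hle j
    omega
  refine ⟨fun j hj => ?_, ?_, ?_⟩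
  · by_contra! hj'
    exact hj (h0 j hj'.1 hj'.2)
  · by_cases hiy : i = y
    · subst hiy; exact hlti.le
    · exact (hi y (hord y i (by grind))).le
  · by_cases hiy : i = y
    · subst hiy; exact .inl hlti
    · right
      by_cases hiz : i = z
      · subst hiz; exact hlti.le
      by_cases hz : u z = 0 ∧ v z = 0
      · rw [h0 z hz.1 hz.2]; exact Nat.zero_le _
      by_cases hzy : z = y
      · subst hzy
        exact (hi z (hord z i (by grind))).le
      · exact (hi z (hord z i (by grind))).le

/-- Make a variable of the common term `e` the greatest. By coprimality `e` then leads both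
binomials, contrary to `degree_ne`. -/
theorem eq_of_mem_support (hF : IsRobustQuadratic F) {e : σ →₀ ℕ} {f g : MvPolynomial σ k}
    (hf : f ∈ F) (hg : g ∈ F) (hef : e ∈ f.support) (heg : e ∈ g.support) : f = g := by
  classical
  by_contra hfg
  have hexists : ∀ {f : MvPolynomial σ k}, f ∈ F → e ∈ f.support →
      ∃ e', (f.support : Set (σ →₀ ℕ)) = {e, e'} ∧ IsBinomialEdge F e e' := by
    intro f hf hef
    obtain ⟨u, v, -, hs, hE⟩ := exists_isBinomialEdge hf (hF.bin f hf).2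
    have : e ∈ (f.support : Set (σ →₀ ℕ)) := hef
    rw [hs] at this
    rcases this with h | h
    · exact ⟨v, h ▸ hs, h ▸ hE⟩
    · rw [Set.mem_singleton_iff.1 h]
      exact ⟨u, by rw [hs, Set.pair_comm], hE.symm⟩
  obtain ⟨e', hs, h⟩ := hexists hf hef
  obtain ⟨e'', hs', h'⟩ := hexists hg heg
  have h0 : e ≠ 0 := by
    rintro rfl
    have := degree_of_isBinomialEdge hF.bin h
    simp at this
  obtain ⟨i, hi⟩ := Finsupp.ne_iff.1 h0
  obtain ⟨_, hord⟩ := exists_linearOrder (σ := σ) fun j => if j = i then 0 else 1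
  have key : ∀ {f : MvPolynomial σ k} {e'}, f ≠ 0 → (f.support : Set (σ →₀ ℕ)) = {e, e'} →
      IsBinomialEdge F e e' → MonomialOrder.lex.degree f = e := by
    intro f e' hf0 hs hE
    have hmem : MonomialOrder.lex.degree f ∈ (f.support : Set (σ →₀ ℕ)) :=
      MonomialOrder.degree_mem_support hf0
    have hle : e ≼[MonomialOrder.lex] MonomialOrder.lex.degree f := by
      apply MonomialOrder.le_degree
      have : e ∈ (f.support : Set (σ →₀ ℕ)) := by rw [hs]; simp
      exact this
    rw [hs] at hmem
    rcases hmem with h | h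
    · exact h
    · exfalso
      rw [Set.mem_singleton_iff.1 h, MonomialOrder.lex_le_iff] at hle
      refine not_lt.2 hle (Finsupp.Lex.lt_iff.2 ⟨i, fun j hj => ?_, ?_⟩)
      · by_cases hji : j = i
        · exact (hj.ne hji).elim
        · exact (lt_asymm hj (hord i j (by simp [hji]))).elim
      · have := (hE.coprime hF.prime hF.bin i).resolve_left hi
        simp only [ofLex_toLex, this]
        exact Nat.pos_of_ne_zero hi
  refine (hF.degree_ne hf hg hfg ?_).elim
  rw [key (hF.prime f hf).ne_zero hs h, key (hF.prime g hg).ne_zero hs' h']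

theorem edge_unique (hF : IsRobustQuadratic F) {e e' e'' : σ →₀ ℕ} (h : IsBinomialEdge F e e')
    (h' : IsBinomialEdge F e e'') : e' = e'' := by
  obtain ⟨hne, f, hf, hs⟩ := h
  obtain ⟨hne', g, hg, hs'⟩ := h'
  have hfg : f = g := hF.eq_of_mem_support (e := e) hf hg (by rw [← Finset.mem_coe, hs]; simp)
    (by rw [← Finset.mem_coe, hs']; simp)
  subst hfg
  rw [hs] at hs'
  have : e' ∈ ({e, e''} : Set (σ →₀ ℕ)) := by rw [← hs']; simp
  exact this.resolve_left hne.symm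

end IsRobustQuadratic

section Pairs

variable {σ : Type u}

theorem single_add_single_inj {a b c d : σ}
    (h : Finsupp.single a 1 + Finsupp.single b 1 = Finsupp.single c 1 + (Finsupp.single d 1 : σ →₀ ℕ)) :
    (a = c ∧ b = d) ∨ (a = d ∧ b = c) := by
  rw [Finsupp.single_add_single_eq_single_add_single one_ne_zero one_ne_zero] at h
  grind

theorem pair_le_triple {a b c i j : σ} (h : Finsupp.single i 1 + Finsupp.single j 1 ≤
    Finsupp.single a 1 + Finsupp.single b 1 + (Finsupp.single c 1 : σ →₀ ℕ)) :
    (i = a ∧ (j = b ∨ j = c)) ∨ (i = b ∧ (j = a ∨ j = c)) ∨ (i = c ∧ (j = a ∨ j = b)) := by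
  classical
  have step : ∀ {j : σ} {w : σ →₀ ℕ}, Finsupp.single j 1 ≤ w → w j ≠ 0 := by
    intro j w h
    have := h j
    simp at this
    omega
  have aux : ∀ {a b : σ}, Finsupp.single j 1 ≤ Finsupp.single a 1 + (Finsupp.single b 1 : σ →₀ ℕ) →
      j = a ∨ j = b := by
    intro a b h
    have := step h
    simp only [Finsupp.add_apply, Finsupp.single_apply] at this
    grind
  have hi : i = a ∨ i = b ∨ i = c := by
    have := step (le_trans le_self_add h)
    simp only [Finsupp.add_apply, Finsupp.single_apply] at this
    grind
  rcases hi with rfl | rfl | rfl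
  · rw [add_assoc, add_le_add_iff_left] at h
    exact .inl ⟨rfl, aux h⟩
  · rw [add_comm (Finsupp.single a 1), add_assoc, add_le_add_iff_left] at h
    exact .inr (.inl ⟨rfl, aux h⟩)
  · rw [add_comm _ (Finsupp.single i 1), add_le_add_iff_left] at h
    exact .inr (.inr ⟨rfl, aux h⟩)

theorem triple_apply_ne_zero {a b c t : σ}
    (h : (Finsupp.single a 1 + Finsupp.single b 1 + Finsupp.single c 1 : σ →₀ ℕ) t ≠ 0) :
    t = a ∨ t = b ∨ t = c := by
  classical
  simp only [Finsupp.add_apply, Finsupp.single_apply] at h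
  grind

theorem pair_apply_eq_zero_iff {a b t : σ} :
    (Finsupp.single a 1 + Finsupp.single b 1 : σ →₀ ℕ) t = 0 ↔ t ≠ a ∧ t ≠ b := by
  classical
  simp only [Finsupp.add_apply, Finsupp.single_apply]
  grind

end Pairs

namespace IsRobustQuadratic

variable {σ : Type u} [Finite σ] {k : Type v} [Field k] {F : Set (MvPolynomial σ k)}

theorem not_isBinomialEdge_sq (hF : IsRobustQuadratic F) (a c : σ) :
    ¬ IsBinomialEdge F (Finsupp.single a 1 + Finsupp.single a 1)
      (Finsupp.single c 1 + Finsupp.single c 1) := by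
  rintro ⟨hne, f, hf, hs⟩
  refine hF.nonsq f hf a c (coeff (Finsupp.single a 1 + Finsupp.single a 1) f)
    (coeff (Finsupp.single c 1 + Finsupp.single c 1) f) ?_
  conv_lhs => rw [eq_monomial_add_monomial hne hs]
  simp only [← Finsupp.single_add, X_pow_eq_monomial, C_mul_monomial, mul_one, one_add_one_eq_two]

theorem exists_edge_of_congr_cubic (hF : IsRobustQuadratic F) {a b c d e f : σ}
    {v : σ →₀ ℕ} (hv : v = Finsupp.single d 1 + Finsupp.single e 1 + Finsupp.single f 1)
    (h : MonomialCongr (Ideal.span F)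
      (Finsupp.single a 1 + Finsupp.single b 1 + Finsupp.single c 1) v) (z : σ)
    (hlt : v a < (Finsupp.single a 1 + Finsupp.single b 1 + Finsupp.single c 1 : σ →₀ ℕ) a) :
    ∃ i j k l, ((i = a ∧ (j = b ∨ j = c)) ∨ (i = b ∧ j = c)) ∧ k ≠ a ∧ l ≠ a ∧
      (k = b ∨ k = c ∨ k = d ∨ k = e ∨ k = f) ∧ (l = b ∨ l = c ∨ l = d ∨ l = e ∨ l = f) ∧
      (a = i ∨ a = j ∨ (k ≠ z ∧ l ≠ z)) ∧
      IsBinomialEdge F (Finsupp.single i 1 + Finsupp.single j 1)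
        (Finsupp.single k 1 + Finsupp.single l 1) := by
  classical
  obtain ⟨u, u', hE, hle, hsupp, hy, hz⟩ := hF.exists_edge_of_congr h a z hlt
  obtain ⟨i, j, rfl⟩ := exists_eq_single_add_single (degree_of_isBinomialEdge hF.bin hE)
  obtain ⟨p, q, rfl⟩ := exists_eq_single_add_single (degree_of_isBinomialEdge hF.bin hE.symm)
  have hco := fun t => hE.coprime hF.prime hF.bin t
  have hlow : ∀ t, (Finsupp.single i 1 + Finsupp.single j 1 : σ →₀ ℕ) t = 0 →
      ((Finsupp.single p 1 + Finsupp.single q 1 : σ →₀ ℕ) t ≤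
        (Finsupp.single i 1 + Finsupp.single j 1 : σ →₀ ℕ) t) →
      p ≠ t ∧ q ≠ t := by
    intro t h0 h1
    rw [h0, Nat.le_zero, pair_apply_eq_zero_iff] at h1
    exact ⟨h1.1.symm, h1.2.symm⟩
  -- Coprimality turns a degree inequality at `t` into the absence of `t` from the smaller term.
  have hlow' : ∀ t, ((Finsupp.single p 1 + Finsupp.single q 1 : σ →₀ ℕ) t ≤
        (Finsupp.single i 1 + Finsupp.single j 1 : σ →₀ ℕ) t) → p ≠ t ∧ q ≠ t := by
    intro t h1
    rcases hco t with h | h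
    · exact hlow t h h1
    · rw [pair_apply_eq_zero_iff] at h
      exact ⟨h.1.symm, h.2.symm⟩
  obtain ⟨hpa, hqa⟩ := hlow' a hy
  have hz' : a = i ∨ a = j ∨ (p ≠ z ∧ q ≠ z) := by
    rcases hz with hz | hz
    · have hne : (Finsupp.single i 1 + Finsupp.single j 1 : σ →₀ ℕ) a ≠ 0 := by omega
      rw [Ne, pair_apply_eq_zero_iff, not_and_or, not_not, not_not] at hne
      exact hne.elim .inl fun h => .inr (.inl h)
    · exact .inr (.inr (hlow' z hz))
  have hmem : ∀ t, t ≠ a → (Finsupp.single p 1 + Finsupp.single q 1 : σ →₀ ℕ) t ≠ 0 →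
      t = b ∨ t = c ∨ t = d ∨ t = e ∨ t = f := by
    intro t hta ht
    rcases hsupp t ht with h | h
    · rcases triple_apply_ne_zero h with h | h | h
      · exact (hta h).elim
      · exact .inl h
      · exact .inr (.inl h)
    · rw [hv] at h
      exact .inr (.inr (triple_apply_ne_zero h))
  have hp' := hmem p hpa (by rw [Ne, pair_apply_eq_zero_iff]; simp)
  have hq' := hmem q hqa (by rw [Ne, pair_apply_eq_zero_iff]; simp)
  have hij := pair_le_triple hle
  have hz'' : a = j ∨ a = i ∨ (p ≠ z ∧ q ≠ z) := or_left_comm.1 hz'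
  have hE' := hE
  rw [add_comm (Finsupp.single i 1)] at hE'
  rcases hij with ⟨hi, hj⟩ | ⟨hi, hj | hj⟩ | ⟨hi, hj⟩
  · exact ⟨i, j, p, q, .inl ⟨hi, hj⟩, hpa, hqa, hp', hq', hz', hE⟩
  · exact ⟨j, i, p, q, .inl ⟨hj, .inl hi⟩, hpa, hqa, hp', hq', hz'', hE'⟩
  · exact ⟨i, j, p, q, .inr ⟨hi, hj⟩, hpa, hqa, hp', hq', hz', hE⟩
  · rcases hj with hj | hj
    · exact ⟨j, i, p, q, .inl ⟨hj, .inr hi⟩, hpa, hqa, hp', hq', hz'', hE'⟩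
    · exact ⟨j, i, p, q, .inr ⟨hj, hi⟩, hpa, hqa, hp', hq', hz'', hE'⟩

/-- The combinatorial model of a lexicographically robust set of quadratic binomials. -/
def system (hF : IsRobustQuadratic F) : QuadricSystem σ where
  E a b c d := IsBinomialEdge F (Finsupp.single a 1 + Finsupp.single b 1)
    (Finsupp.single c 1 + Finsupp.single d 1)
  C a b c d e f := MonomialCongr (Ideal.span F)
    (Finsupp.single a 1 + Finsupp.single b 1 + Finsupp.single c 1)
    (Finsupp.single d 1 + Finsupp.single e 1 + Finsupp.single f 1)
  symm h := h.symm
  comm {a b c d} h := by rwa [add_comm (Finsupp.single b 1)]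
  disj {a b c d} h := by
    rintro rfl
    have := h.coprime hF.prime hF.bin a
    simp at this
  nonsq := hF.not_isBinomialEdge_sq _ _
  uniq h h' := single_add_single_inj (hF.edge_unique h h')
  csymm h := h.symm
  cswap {a b c d e f} h := by rwa [add_comm (Finsupp.single b 1)]
  crot {a b c d e f} h := by
    rwa [add_comm (_ + _) (Finsupp.single a 1), ← add_assoc]
  spair {x a b p q r s} h1 h2 := by
    have e1 := ((MonomialCongr.of_isBinomialEdge h1).add_right (Finsupp.single b 1)).symm
    have e2 := (MonomialCongr.of_isBinomialEdge h2).add_right (Finsupp.single a 1)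
    have := e1.trans (by convert e2 using 1; abel)
    convert this using 1 <;> abel
  step {a b c x y z v w} h1 h2 :=
    h1.trans ((MonomialCongr.of_isBinomialEdge h2).add_right (Finsupp.single z 1))
  red {a b c d e f} h z had hae haf := by
    classical
    obtain ⟨i, j, k, l, hij, hk, hl, hk', hl', hz, hE⟩ := hF.exists_edge_of_congr_cubic rfl h z (by
      simp [Finsupp.single_apply, had.symm, hae.symm, haf.symm])
    refine ⟨k, l, hk, hl, hk', hl', ?_⟩
    rcases hij with ⟨rfl, rfl | rfl⟩ | ⟨rfl, rfl⟩
    · exact .inl hE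
    · exact .inr (.inl hE)
    · exact .inr (.inr ⟨hE, hz⟩)
  red_sq {a b d e f} h hae haf := by
    classical
    obtain ⟨i, j, k, l, hij, hk, hl, hk', hl', hz, hE⟩ := hF.exists_edge_of_congr_cubic rfl h a (by
      simp only [Finsupp.add_apply, Finsupp.single_apply]
      split_ifs <;> simp_all)
    refine ⟨k, l, hk, hl, by simpa [hk] using hk', by simpa [hl] using hl', ?_⟩
    rcases hij with ⟨rfl, rfl | rfl⟩ | ⟨rfl, rfl⟩
    · exact .inl hE
    · exact .inr hE
    · exact .inr hE

end IsRobustQuadratic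

theorem QuadricSystem.IsColumn.fst_ne_snd {σ : Type*} {Q : QuadricSystem σ} {x a b p q r : σ}
    (h1 : Q.E x a p q) (h2 : Q.E x b r q) (hab : a ≠ b) {y z y' z' : σ} (hc : Q.IsColumn x q y z)
    (hd : Q.IsColumn x q y' z') : y ≠ z' := by
  obtain ⟨a', b', p', r', hab', h1', h2'⟩ := hc.exists_pair h1 h2 hab
  by_cases hz : z = z'
  · exact hz ▸ (Q.ne_all h1').2.1
  · rintro rfl
    have := hc.E hd hz
    exact hab' ((Q.eq_of_sq this h1').trans (Q.eq_of_sq this h2').symm)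

/-! ### A component with two members consists of minors -/

section Decomposition

variable {σ : Type u} {k : Type v} [Field k] {F G : Set (MvPolynomial σ k)}

/-- `f` is a binomial with terms `ij` and `kl`. -/
def HasTerms (f : MvPolynomial σ k) (i j k' l : σ) : Prop :=
  (f.support : Set (σ →₀ ℕ)) =
    {Finsupp.single i 1 + Finsupp.single j 1, Finsupp.single k' 1 + Finsupp.single l 1}

theorem HasTerms.mem_vars {f : MvPolynomial σ k} {i j k' l t : σ} (h : HasTerms f i j k' l) :
    t ∈ f.vars ↔ t = i ∨ t = j ∨ t = k' ∨ t = l := by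
  classical
  have hmem : ∀ d, d ∈ f.support ↔ d = Finsupp.single i 1 + Finsupp.single j 1 ∨
      d = Finsupp.single k' 1 + Finsupp.single l 1 := by
    intro d
    rw [← Finset.mem_coe, h]
    simp
  simp only [MvPolynomial.mem_vars_iff_mem_support, hmem, Finsupp.mem_support_iff]
  have := fun a b => @pair_apply_eq_zero_iff σ a b t
  constructor
  · rintro ⟨d, rfl | rfl, hd⟩
    · rw [Ne, this] at hd; tauto
    · rw [Ne, this] at hd; tauto
  · intro ht
    by_cases h : t = i ∨ t = j
    · exact ⟨_, .inl rfl, by rw [Ne, this]; tauto⟩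
    · exact ⟨_, .inr rfl, by rw [Ne, this]; tauto⟩

theorem exists_common_var (hG : ∀ A B, IsVariableDecomposition G A B → A = ∅ ∨ B = ∅)
    (hne : G.Nonempty) (hs : ¬ ∃ f, G = {f}) :
    ∃ f ∈ G, ∃ g ∈ G, f ≠ g ∧ ∃ x, x ∈ f.vars ∧ x ∈ g.vars := by
  by_contra! h
  obtain ⟨f, hf⟩ := hne
  have := hG {f} (G \ {f}) ⟨by simp [hf], ?_⟩
  · rcases this with h | h
    · simp at h
    · exact hs ⟨f, (Set.sdiff_eq_empty.1 h).antisymm (by simpa using hf)⟩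
  · rw [Set.disjoint_left]
    rintro x ⟨f', rfl, hx⟩ ⟨g, ⟨hg, hgf⟩, hx'⟩
    exact h _ hf g hg (fun h => hgf h.symm) x hx hx'

end Decomposition

namespace IsRobustQuadratic

variable {σ : Type u} [Finite σ] {k : Type v} [Field k] {F : Set (MvPolynomial σ k)}

theorem exists_hasTerms (hF : IsRobustQuadratic F) {f : MvPolynomial σ k} (hf : f ∈ F) {x : σ}
    (hx : x ∈ f.vars) : ∃ a p q, HasTerms f x a p q ∧ hF.system.E x a p q := by
  classical
  obtain ⟨d, hd, hxd⟩ := (mem_vars_iff_mem_support x).1 hx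
  obtain ⟨u, v, -, hs, hE⟩ := exists_isBinomialEdge hf (hF.bin f hf).2
  obtain ⟨i, j, rfl⟩ := exists_eq_single_add_single (degree_of_isBinomialEdge hF.bin hE)
  obtain ⟨m, n, rfl⟩ := exists_eq_single_add_single (degree_of_isBinomialEdge hF.bin hE.symm)
  have hT : HasTerms f i j m n := hs
  rcases hT.mem_vars.1 hx with rfl | rfl | rfl | rfl
  · exact ⟨j, m, n, hs, hE⟩
  · rw [add_comm (Finsupp.single i 1)] at hs hE
    exact ⟨i, m, n, hs, hE⟩
  · rw [Set.pair_comm] at hs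
    exact ⟨n, i, j, hs, hE.symm⟩
  · rw [Set.pair_comm, add_comm (Finsupp.single m 1)] at hs
    rw [add_comm (Finsupp.single m 1)] at hE
    exact ⟨m, i, j, hs, hE.symm⟩

theorem exists_of_E (hF : IsRobustQuadratic F) {a b c d : σ} (h : hF.system.E a b c d) :
    ∃ f ∈ F, HasTerms f a b c d := by
  obtain ⟨-, f, hf, hs⟩ := h
  exact ⟨f, hf, hs⟩

theorem eq_of_hasTerms (hF : IsRobustQuadratic F) {f g : MvPolynomial σ k} (hf : f ∈ F)
    (hg : g ∈ F) {a b c d c' d' : σ} (h : HasTerms f a b c d) (h' : HasTerms g a b c' d') :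
    f = g :=
  hF.eq_of_mem_support (e := Finsupp.single a 1 + Finsupp.single b 1) hf hg (by rw [← Finset.mem_coe, h]; simp)
    (by rw [← Finset.mem_coe, h']; simp)

/-- The binomials supported on the minors of the matrix with corner column `(x, q)`. -/
def minorsOf (hF : IsRobustQuadratic F) (x q : σ) : Set (MvPolynomial σ k) :=
  {f | f ∈ F ∧ ∃ y z y' z', hF.system.IsColumn x q y z ∧ hF.system.IsColumn x q y' z' ∧ z ≠ z' ∧
    HasTerms f y z' y' z}

variable (hF : IsRobustQuadratic F) {x a b p q r : σ}

/-- The minors are closed under sharing a variable, so they split off from any set of variables they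
do not touch. -/
theorem mem_minorsOf_of_common_var (h1 : hF.system.E x a p q) (h2 : hF.system.E x b r q)
    (hab : a ≠ b) {f g : MvPolynomial σ k} (hf : f ∈ hF.minorsOf x q) (hg : g ∈ F) {t : σ}
    (htf : t ∈ f.vars) (htg : t ∈ g.vars) : g ∈ hF.minorsOf x q := by
  have key : ∀ y z, hF.system.IsColumn x q y z → (t = y ∨ t = z) → g ∈ hF.minorsOf x q := by
    intro y z hc ht
    obtain ⟨j, m, n, hT, hE⟩ := hF.exists_hasTerms hg htg
    refine ⟨hg, ?_⟩
    rcases ht with rfl | rfl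
    · obtain ⟨d, hd, H⟩ := hc.exists_of_E_fst h1 h2 hab hE
      have hT' : HasTerms g t j d z := by
        rcases H with ⟨rfl, rfl⟩ | ⟨rfl, rfl⟩
        · exact hT
        · rw [HasTerms, add_comm (Finsupp.single n 1)]; exact hT
      refine ⟨t, z, d, j, hc, hd, ?_, hT'⟩
      rintro rfl
      have := hd.eq_iff hc rfl
      have := hF.system.ne_all hE
      grind
    · obtain ⟨d, hd, H⟩ := hc.exists_of_E_snd h1 h2 hab hE
      have hT' : HasTerms g j t y d := by
        rw [HasTerms, add_comm (Finsupp.single j 1), add_comm (Finsupp.single y 1)]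
        rcases H with ⟨rfl, rfl⟩ | ⟨rfl, rfl⟩
        · exact hT
        · rw [add_comm (Finsupp.single n 1)]; exact hT
      refine ⟨j, d, y, t, hd, hc, ?_, hT'⟩
      rintro rfl
      have := hF.system.ne_all hE
      have := hd.eq_iff hc rfl
      grind
  obtain ⟨-, y, z, y', z', hc, hd, -, hT⟩ := hf
  rcases hT.mem_vars.1 htf with h | h | h | h
  · exact key y z hc (.inl h)
  · exact key y' z' hd (.inr h)
  · exact key y' z' hd (.inl h)
  · exact key y z hc (.inr h)

/-- Irreducibility gives one inclusion. For the other, each first-row entry `y` occurs together with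
`x` in some binomial of `F`, which ties every minor to `G`. -/
theorem eq_minorsOf {G : Set (MvPolynomial σ k)} (hG : IsIrreducibleComponent F G)
    (h1 : hF.system.E x a p q) (h2 : hF.system.E x b r q)
    (hab : a ≠ b) {f : MvPolynomial σ k} (hf : f ∈ G) (hT : HasTerms f x a p q) :
    G = hF.minorsOf x q := by
  obtain ⟨-, ⟨H, hFG, hdisj⟩, hirr⟩ := hG
  have hGF : G ⊆ F := hFG ▸ Set.subset_union_left
  have hfC : f ∈ hF.minorsOf x q :=
    ⟨hGF hf, x, q, p, a, .inl ⟨rfl, rfl⟩, .inr h1, (hF.system.ne_all h1).2.2.2.symm, hT⟩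
  apply Set.Subset.antisymm
  · have := hirr (G ∩ hF.minorsOf x q) (G \ hF.minorsOf x q) ⟨by simp, ?_⟩
    · rcases this with h | h
      · exact (Set.notMem_empty f (h ▸ ⟨hf, hfC⟩)).elim
      · exact Set.sdiff_eq_empty.1 h
    · rw [Set.disjoint_left]
      rintro t ⟨g, hg, ht⟩ ⟨g', hg', ht'⟩
      exact hg'.2 (hF.mem_minorsOf_of_common_var h1 h2 hab hg.2 (hGF hg'.1) ht ht')
  · rintro c ⟨hcF, y, z, y', z', hc, hd, hz, hcT⟩
    have hxG : x ∈ variablesOf G := ⟨f, hf, hT.mem_vars.2 (.inl rfl)⟩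
    have hyG : y ∈ variablesOf G := by
      rcases hc with ⟨rfl, rfl⟩ | hc
      · exact hxG
      · obtain ⟨g, hg, hgT⟩ := hF.exists_of_E hc
        have hg' := hg
        rw [hFG] at hg'
        rcases hg' with hg' | hg'
        · exact ⟨g, hg', hgT.mem_vars.2 (by simp)⟩
        · exact (Set.disjoint_left.1 hdisj hxG ⟨g, hg', hgT.mem_vars.2 (.inl rfl)⟩).elim
    rw [hFG] at hcF
    rcases hcF with h | h
    · exact h
    · exact (Set.disjoint_left.1 hdisj hyG ⟨c, h, hcT.mem_vars.2 (.inl rfl)⟩).elim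

end IsRobustQuadratic

/-! ### Coefficients and the rescaled matrix -/

theorem minor_eq {σ : Type u} {k : Type v} [Field k] {n : ℕ} (x : Fin 2 → Fin n → σ)
    (c : Fin 2 → Fin n → k) (i j : Fin n) :
    ((Matrix.of fun r j => C (c r j) * X (R := k) (x r j)).submatrix id ![i, j]).det =
      monomial (Finsupp.single (x 0 i) 1 + Finsupp.single (x 1 j) 1) (c 0 i * c 1 j) -
      monomial (Finsupp.single (x 0 j) 1 + Finsupp.single (x 1 i) 1) (c 0 j * c 1 i) := by
  rw [Matrix.det_fin_two]
  simp [X, C_mul_monomial, monomial_mul]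

namespace IsRobustQuadratic

variable {σ : Type u} [Finite σ] {k : Type v} [Field k] {F : Set (MvPolynomial σ k)}
  {x a b p q r : σ}

theorem exists_ratio (hF : IsRobustQuadratic F) {y z : σ} (h : hF.system.IsColumn x q y z) :
    ∃ c : k, c ≠ 0 ∧ monomial (Finsupp.single x 1 + Finsupp.single z 1) (1 : k) -
      monomial (Finsupp.single y 1 + Finsupp.single q 1) c ∈ Ideal.span F := by
  rcases h with ⟨rfl, rfl⟩ | h
  · exact MonomialCongr.refl _
  · exact MonomialCongr.of_isBinomialEdge h

/-- A binomial of `F` supported on a minor is a multiple of the rescaled minor. -/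
theorem eq_C_mul_of_hasTerms (hF : IsRobustQuadratic F) {y z y' z' : σ} {c c' : k} (hc0 : c ≠ 0)
    (hc : monomial (Finsupp.single x 1 + Finsupp.single z 1) (1 : k) -
      monomial (Finsupp.single y 1 + Finsupp.single q 1) c ∈ Ideal.span F)
    (hc' : monomial (Finsupp.single x 1 + Finsupp.single z' 1) (1 : k) -
      monomial (Finsupp.single y' 1 + Finsupp.single q 1) c' ∈ Ideal.span F)
    {f : MvPolynomial σ k} (hf : f ∈ F) (hT : HasTerms f y z' y' z)
    (hne : Finsupp.single y 1 + Finsupp.single z' 1 ≠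
      Finsupp.single y' 1 + (Finsupp.single z 1 : σ →₀ ℕ)) :
    ∃ α : k, α ≠ 0 ∧ f = C α *
      (monomial (Finsupp.single y 1 + Finsupp.single z' 1) c -
        monomial (Finsupp.single y' 1 + Finsupp.single z 1) c') := by
  have heq := eq_monomial_add_monomial hne hT
  obtain ⟨hα, hβ⟩ := mem_support_of_pair hT
  generalize coeff (Finsupp.single y 1 + Finsupp.single z' 1) f = α at *
  generalize coeff (Finsupp.single y' 1 + Finsupp.single z 1) f = β at *
  have e1 := (Ideal.span F).mul_mem_left (X z') hc
  have e2 := (Ideal.span F).mul_mem_left (X z) hc'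
  have e3 := (Ideal.span F).mul_mem_left (X q) (Ideal.subset_span hf)
  have e4 : monomial (Finsupp.single q 1 + (Finsupp.single y' 1 + Finsupp.single z 1))
      (c * β + α * c') ∈ Ideal.span F := by
    have := sub_mem ((Ideal.span F).mul_mem_left (C c) e3)
      ((Ideal.span F).mul_mem_left (C α) (sub_mem e2 e1))
    convert this using 1
    rw [heq]
    simp only [X, mul_sub, mul_add, C_mul_monomial, monomial_mul, one_mul, mul_one, map_add]
    have t1 : Finsupp.single z' 1 + (Finsupp.single x 1 + Finsupp.single z 1) =
      Finsupp.single z 1 + (Finsupp.single x 1 + (Finsupp.single z' 1 : σ →₀ ℕ)) := by abel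
    have t2 : Finsupp.single z' 1 + (Finsupp.single y 1 + Finsupp.single q 1) =
      Finsupp.single q 1 + (Finsupp.single y 1 + (Finsupp.single z' 1 : σ →₀ ℕ)) := by abel
    have t3 : Finsupp.single z 1 + (Finsupp.single y' 1 + Finsupp.single q 1) =
      Finsupp.single q 1 + (Finsupp.single y' 1 + (Finsupp.single z 1 : σ →₀ ℕ)) := by abel
    rw [t1, t2, t3, mul_comm α c]
    ring
  -- `e4` places a monomial with this coefficient in the ideal, so the coefficient vanishes.
  have h0 : c * β + α * c' = 0 := by
    by_contra h0
    exact hF.monomial_notMem _ h0 e4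
  refine ⟨α / c, div_ne_zero hα hc0, ?_⟩
  rw [heq]
  simp only [mul_sub, C_mul_monomial]
  rw [div_mul_cancel₀ _ hc0, sub_eq_add_neg, ← map_neg]
  congr 2
  field_simp
  linear_combination h0

theorem span_minorsOf (hF : IsRobustQuadratic F) (h1 : hF.system.E x a p q) (h2 : hF.system.E x b r q) (hab : a ≠ b) :
    IsGenericDeterminantal (Ideal.span (hF.minorsOf x q)) := by
  classical
  let S := {c : σ × σ // hF.system.IsColumn x q c.1 c.2}
  have : Finite S := inferInstance
  obtain ⟨n, ⟨e⟩⟩ := Finite.exists_equiv_fin S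
  choose γ hγ hγI using fun c : S => hF.exists_ratio c.2
  have hfst : ∀ c d : S, c.1.1 = d.1.1 → c = d := fun c d h =>
    Subtype.ext (Prod.ext h (c.2.swap.eq_iff d.2.swap h))
  have hsnd : ∀ c d : S, c.1.2 = d.1.2 → c = d := fun c d h =>
    Subtype.ext (Prod.ext (c.2.eq_iff d.2 h) h)
  have hdisj : ∀ c d : S, c.1.1 ≠ d.1.2 := fun c d =>
    QuadricSystem.IsColumn.fst_ne_snd h1 h2 hab c.2 d.2
  have hne : ∀ c d : S, c ≠ d → Finsupp.single c.1.1 1 + Finsupp.single d.1.2 1 ≠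
      Finsupp.single d.1.1 1 + (Finsupp.single c.1.2 1 : σ →₀ ℕ) := by
    intro c d hcd h
    rcases single_add_single_inj h with h | h
    · exact hcd (hfst _ _ h.1)
    · exact hdisj _ _ h.1
  -- All scaling goes into the first row: `γ` is the constant in `xz ≡ γ yq` for the column `(y,
  -- z)`.
  refine ⟨n, ![fun j => (e.symm j).1.1, fun j => (e.symm j).1.2], ![fun j => γ (e.symm j), 1],
    ?_, ?_, ?_, ?_⟩
  · by_contra hn
    have hsub : Subsingleton (Fin n) := Fin.subsingleton_iff_le_one.2 (by omega)
    have hS : Subsingleton S := e.subsingleton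
    have := congrArg (fun c : S => c.1.2)
      (Subsingleton.elim (⟨(x, q), .inl ⟨rfl, rfl⟩⟩ : S) ⟨(p, a), .inr h1⟩)
    exact (hF.system.ne_all h1).2.2.2 this.symm
  · rintro ⟨i, j⟩ ⟨i', j'⟩ h
    simp only [Function.uncurry] at h
    fin_cases i <;> fin_cases i' <;> simp at h ⊢
    · exact e.symm.injective (hfst _ _ h)
    · exact hdisj _ _ h
    · exact hdisj _ _ h.symm
    · exact e.symm.injective (hsnd _ _ h)
  · intro i j
    fin_cases i <;> simp [hγ]
  · apply le_antisymm
    · rw [Ideal.span_le]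
      rintro f ⟨hf, y, z, y', z', hc, hd, hz, hT⟩
      let c : S := ⟨(y, z), hc⟩
      let d : S := ⟨(y', z'), hd⟩
      have hcd : c ≠ d := fun h => hz (congrArg (fun c : S => c.1.2) h)
      obtain ⟨α, -, rfl⟩ := hF.eq_C_mul_of_hasTerms (hγ c) (hγI c) (hγI d) hf hT (hne c d hcd)
      refine Ideal.mul_mem_left _ _ ?_
      rcases lt_or_gt_of_ne (e.injective.ne hcd) with hlt | hlt
      · refine Ideal.subset_span ⟨e c, e d, hlt, ?_⟩
        rw [minor_eq]
        simp
      · rw [← neg_mem_iff]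
        refine Ideal.subset_span ⟨e d, e c, hlt, ?_⟩
        rw [minor_eq]
        simp
    · rw [twoMinorsIdeal, Ideal.span_le]
      rintro _ ⟨i, j, hij, rfl⟩
      rw [minor_eq]
      have hcd : e.symm i ≠ e.symm j := e.symm.injective.ne hij.ne
      have hz : (e.symm i).1.2 ≠ (e.symm j).1.2 := fun h => hcd (hsnd _ _ h)
      obtain ⟨f, hf, hT⟩ := hF.exists_of_E ((e.symm i).2.E (e.symm j).2 hz)
      have hmem : f ∈ hF.minorsOf x q := ⟨hf, _, _, _, _, (e.symm i).2, (e.symm j).2, hz, hT⟩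
      obtain ⟨α, hα, hfα⟩ := hF.eq_C_mul_of_hasTerms (hγ _) (hγI _) (hγI _) hf hT (hne _ _ hcd)
      have := (Ideal.span (hF.minorsOf x q)).mul_mem_left (C α⁻¹) (Ideal.subset_span hmem)
      rw [hfα, ← mul_assoc, ← C_mul, inv_mul_cancel₀ hα, C_1, one_mul] at this
      simpa using this

theorem isGenericDeterminantal_or_singleton (hF : IsRobustQuadratic F) {G : Set (MvPolynomial σ k)}
    (hG : IsIrreducibleComponent F G) :
    IsGenericDeterminantal (Ideal.span G) ∨ ∃ f, G = {f} := by
  by_cases hs : ∃ f, G = {f}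
  · exact .inr hs
  left
  obtain ⟨f, hf, g, hg, hfg, x, hxf, hxg⟩ := exists_common_var hG.2.2 hG.1 hs
  have hGF : G ⊆ F := by
    obtain ⟨H, h, -⟩ := hG.2.1
    exact h ▸ Set.subset_union_left
  obtain ⟨a, p, q, hT, hE⟩ := hF.exists_hasTerms (hGF hf) hxf
  obtain ⟨b, r, t, hT', hE'⟩ := hF.exists_hasTerms (hGF hg) hxg
  have hab : a ≠ b := by
    rintro rfl
    exact hfg (hF.eq_of_hasTerms (hGF hf) (hGF hg) hT hT')
  have main : ∀ {p q r}, HasTerms f x a p q → hF.system.E x a p q → hF.system.E x b r q →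
      IsGenericDeterminantal (Ideal.span G) := by
    intro p q r hT h1 h2
    rw [hF.eq_minorsOf hG h1 h2 hab hf hT]
    exact hF.span_minorsOf h1 h2 hab
  have hTs : HasTerms f x a q p := by
    rw [HasTerms, add_comm (Finsupp.single q 1)]; exact hT
  rcases hF.system.E_cross hE hE' hab with ⟨rfl, -⟩ | ⟨rfl, -⟩ | ⟨rfl, -⟩ | ⟨rfl, -⟩
  · exact main hT hE hE'
  · exact main hT hE (hF.system.comm' hE')
  · exact main hTs (hF.system.comm' hE) hE'
  · exact main hTs (hF.system.comm' hE) (hF.system.comm' hE')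

end IsRobustQuadratic

/-! ### Monomial parametrizations and an order-free Gröbner criterion -/

section Parametrization

variable {σ : Type u} {k : Type v} [Field k] {M : Type*} [AddCommMonoid M]

/-- The monomial parametrization `X i ↦ lam i * T ^ w i`. -/
noncomputable def paramHom (w : σ → M) (lam : σ → k) :
    MvPolynomial σ k →ₐ[k] AddMonoidAlgebra k M :=
  aeval fun i => AddMonoidAlgebra.single (w i) (lam i)

theorem paramHom_monomial (w : σ → M) (lam : σ → k) (u : σ →₀ ℕ) (c : k) :
    paramHom w lam (monomial u c) = AddMonoidAlgebra.single (Finsupp.linearCombination ℕ w u)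
      (c * u.prod fun i n => lam i ^ n) := by
  classical
  rw [paramHom, aeval_monomial]
  have : ∀ u : σ →₀ ℕ, (u.prod fun i n => (AddMonoidAlgebra.single (w i) (lam i)) ^ n) =
      AddMonoidAlgebra.single (Finsupp.linearCombination ℕ w u)
        (u.prod fun i n => lam i ^ n) := by
    intro u
    induction u using Finsupp.induction_linear with
    | zero => simp [AddMonoidAlgebra.one_def]
    | add u v hu hv =>
      rw [Finsupp.prod_add_index' (by simp) (by simp [pow_add]), hu, hv,
        AddMonoidAlgebra.single_mul_single, map_add,
        Finsupp.prod_add_index' (by simp) (by simp [pow_add])]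
    | single i n => simp [AddMonoidAlgebra.single_pow]
  rw [this]
  simp [AddMonoidAlgebra.coe_algebraMap, AddMonoidAlgebra.single_mul_single]

theorem prod_pow_ne_zero {lam : σ → k} (hlam : ∀ i, lam i ≠ 0) (u : σ →₀ ℕ) :
    (u.prod fun i n => lam i ^ n) ≠ 0 :=
  Finset.prod_ne_zero_iff.2 fun i _ => pow_ne_zero _ (hlam i)

theorem weight_eq_of_paramHom_eq_zero {w : σ → M} {lam : σ → k} (hlam : ∀ i, lam i ≠ 0)
    {f : MvPolynomial σ k} {u v : σ →₀ ℕ} (hne : u ≠ v)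
    (hs : (f.support : Set (σ →₀ ℕ)) = {u, v}) (hf : paramHom w lam f = 0) :
    Finsupp.linearCombination ℕ w u = Finsupp.linearCombination ℕ w v := by
  classical
  by_contra h
  rw [eq_monomial_add_monomial hne hs, map_add, paramHom_monomial, paramHom_monomial] at hf
  have := congrArg (fun x => x.coeff (Finsupp.linearCombination ℕ w u)) hf
  simp [Ne.symm h, prod_pow_ne_zero hlam,
    (mem_support_of_pair hs).1] at this

theorem exists_ne_of_paramHom_eq_zero {w : σ → M} {lam : σ → k} (hlam : ∀ i, lam i ≠ 0)
    {f : MvPolynomial σ k} (hf : paramHom w lam f = 0) {u : σ →₀ ℕ} (hu : u ∈ f.support) :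
    ∃ v ∈ f.support, v ≠ u ∧ Finsupp.linearCombination ℕ w v = Finsupp.linearCombination ℕ w u := by
  classical
  by_contra! h
  rw [f.as_sum, map_sum] at hf
  simp only [paramHom_monomial] at hf
  have := congrArg (fun x => x.coeff (Finsupp.linearCombination ℕ w u)) hf
  simp only [AddMonoidAlgebra.coeff_sum, AddMonoidAlgebra.coeff_single, Finsupp.finsetSum_apply,
    Finsupp.single_apply, AddMonoidAlgebra.coeff_zero, Finsupp.zero_apply] at this
  rw [Finset.sum_eq_single_of_mem u hu fun v hv hvu => if_neg (h v hv hvu), if_pos rfl] at this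
  exact mul_ne_zero (mem_support_iff.1 hu) (prod_pow_ne_zero hlam u) this

theorem degree_of_pair {m : MonomialOrder.{u, u} σ} {f : MvPolynomial σ k} {e e' : σ →₀ ℕ}
    (hs : (f.support : Set (σ →₀ ℕ)) = {e, e'}) (h : e' ≺[m] e) : m.degree f = e := by
  have h0 : f ≠ 0 := by
    rintro rfl
    have := (mem_support_of_pair hs).1
    simp at this
  have hmem : m.degree f ∈ (f.support : Set (σ →₀ ℕ)) := MonomialOrder.degree_mem_support h0
  have hle : e ≼[m] m.degree f := by
    apply MonomialOrder.le_degree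
    rw [← Finset.mem_coe, hs]
    simp
  rw [hs] at hmem
  rcases hmem with h' | h'
  · exact h'
  · rw [Set.mem_singleton_iff.1 h'] at hle
    exact (not_lt.2 hle h).elim

variable {F : Set (MvPolynomial σ k)}

/-- The leading exponent of a kernel element cancels against some smaller exponent `v` of equal
weight. A binomial refining this pair either leads with a divisor of the leading monomial or lowers
`v`. -/
theorem exists_degree_le_of_paramHom_eq_zero {w : σ → M} {lam : σ → k} (hlam : ∀ i, lam i ≠ 0)
    (hF : ∀ f ∈ F, paramHom w lam f = 0)
    (hG : ∀ u v, Finsupp.linearCombination ℕ w u = Finsupp.linearCombination ℕ w v → u ≠ v →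
      ∃ e e', IsBinomialEdge F e e' ∧ e ≤ u ∧ e' ≤ v) (m : MonomialOrder.{u, u} σ)
    {f : MvPolynomial σ k} (hf : paramHom w lam f = 0) (h0 : f ≠ 0) :
    ∃ g ∈ F, g ≠ 0 ∧ m.degree g ≤ m.degree f := by
  obtain ⟨v, hv, hvu, hA⟩ := exists_ne_of_paramHom_eq_zero hlam hf
    (MonomialOrder.degree_mem_support (m := m) h0)
  have hlt : v ≺[m] m.degree f :=
    lt_of_le_of_ne (m.le_degree hv) fun h => hvu (m.toSyn.injective h)
  clear hvu hv
  induction hs : m.toSyn v using WellFoundedLT.induction generalizing v with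
  | ind s ih =>
    subst hs
    have hvu : m.degree f ≠ v := by rintro h; rw [h] at hlt; exact lt_irrefl _ hlt
    obtain ⟨e, e', hE, he, he'⟩ := hG _ _ hA.symm hvu
    obtain ⟨hne, g, hg, hs⟩ := id hE
    by_cases hlt' : e' ≺[m] e
    · refine ⟨g, hg, ?_, ?_⟩
      · rintro rfl
        have := (mem_support_of_pair hs).1
        simp at this
      · rwa [degree_of_pair hs hlt']
    -- The smaller side is rewritten from `e' + t` to `e + t`, with unchanged weight;
    -- well-foundedness ends the process.
    · have hlt'' : e ≺[m] e' :=
        lt_of_le_of_ne (not_lt.1 hlt') fun h => hne (m.toSyn.injective h)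
      obtain ⟨t, rfl⟩ := exists_add_of_le he'
      have hwt := weight_eq_of_paramHom_eq_zero hlam hne hs (hF g hg)
      have hlt3 : e + t ≺[m] e' + t := by
        rw [map_add, map_add]
        exact add_lt_add_left hlt'' _
      exact ih _ hlt3 (e + t) (by rw [← hA, map_add, map_add, hwt]) (hlt3.trans hlt) rfl

/-- Division of a kernel element by `F` leaves a remainder in the kernel; were it nonzero, its
leading monomial would still be divisible. -/
theorem ker_paramHom_eq {w : σ → M} {lam : σ → k} (hlam : ∀ i, lam i ≠ 0)
    (hF : ∀ f ∈ F, paramHom w lam f = 0)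
    (hG : ∀ u v, Finsupp.linearCombination ℕ w u = Finsupp.linearCombination ℕ w v → u ≠ v →
      ∃ e e', IsBinomialEdge F e e' ∧ e ≤ u ∧ e' ≤ v) (m : MonomialOrder.{u, u} σ) :
    RingHom.ker (paramHom w lam) = Ideal.span F := by
  apply le_antisymm
  · intro f hf
    obtain ⟨g, r, hfr, -, hr⟩ := MonomialOrder.div_set (m := m) (B := F \ {0}) (fun b hb =>
      (m.leadingCoeff_ne_zero_iff.2 hb.2).isUnit) f
    have hmem : (Finsupp.linearCombination (MvPolynomial σ k) fun b : (F \ {0} : Set _) =>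
        (b : MvPolynomial σ k)) g ∈ Ideal.span F := by
      rw [Finsupp.linearCombination_apply]
      exact Submodule.sum_mem _ fun b _ => Ideal.mul_mem_left _ _ (Ideal.subset_span b.2.1)
    have hle : Ideal.span F ≤ RingHom.ker (paramHom w lam) := Ideal.span_le.2 fun f hf => hF f hf
    have hr0 : r = 0 := by
      by_contra h0
      have hker : r ∈ RingHom.ker (paramHom w lam) := by
        rw [eq_sub_of_add_eq' hfr.symm]
        exact sub_mem hf (hle hmem)
      obtain ⟨b, hb, hb0, hle⟩ := exists_degree_le_of_paramHom_eq_zero hlam hF hG m hker h0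
      exact hr _ (MonomialOrder.degree_mem_support h0) b ⟨hb, hb0⟩ hle
    rw [hfr, hr0, add_zero]
    exact hmem
  · rw [Ideal.span_le]
    exact fun f hf => hF f hf

theorem isPrime_span_of_paramHom [NoZeroDivisors (AddMonoidAlgebra k M)] {w : σ → M} {lam : σ → k}
    (h : RingHom.ker (paramHom w lam) = Ideal.span F) : (Ideal.span F).IsPrime := by
  have : IsDomain (AddMonoidAlgebra k M) := NoZeroDivisors.to_isDomain _
  rw [← h]
  exact RingHom.ker_isPrime _

end Parametrization

/-! ### Models of single components -/

section LocalModel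

variable {σ : Type u} {k : Type v} [Field k]

theorem paramHom_eq_zero_iff {M : Type*} [AddCommMonoid M] {w : σ → M} {lam : σ → k}
    (hlam : ∀ i, lam i ≠ 0) {f : MvPolynomial σ k} {u v : σ →₀ ℕ} (hne : u ≠ v)
    (hs : (f.support : Set (σ →₀ ℕ)) = {u, v}) :
    paramHom w lam f = 0 ↔ Finsupp.linearCombination ℕ w u = Finsupp.linearCombination ℕ w v ∧
      coeff u f * (u.prod fun i n => lam i ^ n) + coeff v f * (v.prod fun i n => lam i ^ n) = 0 := by
  have heq := eq_monomial_add_monomial hne hs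
  have hφ : paramHom w lam f = AddMonoidAlgebra.single (Finsupp.linearCombination ℕ w u)
      (coeff u f * u.prod fun i n => lam i ^ n) +
      AddMonoidAlgebra.single (Finsupp.linearCombination ℕ w v)
      (coeff v f * v.prod fun i n => lam i ^ n) := by
    conv_lhs => rw [heq, map_add, paramHom_monomial, paramHom_monomial]
  constructor
  · intro h
    have hw := weight_eq_of_paramHom_eq_zero hlam hne hs h
    refine ⟨hw, ?_⟩
    rw [hφ, hw, ← AddMonoidAlgebra.single_add, AddMonoidAlgebra.single_eq_zero] at h
    exact h
  · rintro ⟨hw, h⟩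
    rw [hφ, hw, ← AddMonoidAlgebra.single_add, h, AddMonoidAlgebra.single_zero]

/-- A monomial parametrization, with index set `T`, of the ideal generated by `G` in the
variables `V`, for which the binomials of `G` refine every relation between exponents. -/
def HasLocalModel (T : Type*) (G : Set (MvPolynomial σ k)) (V : Set σ) : Prop :=
  ∃ (w : σ → T → ℕ) (lam : σ → k), (∀ i, lam i ≠ 0) ∧ (∀ f ∈ G, paramHom w lam f = 0) ∧
    ∀ u v : σ →₀ ℕ, (∀ i ∉ V, u i = 0) → (∀ i ∉ V, v i = 0) →
      Finsupp.linearCombination ℕ w u = Finsupp.linearCombination ℕ w v → u ≠ v →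
      ∃ e e', IsBinomialEdge G e e' ∧ e ≤ u ∧ e' ≤ v

theorem linearCombination_apply_apply {T : Type*} (w : σ → T → ℕ) (u : σ →₀ ℕ) (t : T) :
    Finsupp.linearCombination ℕ w u t = u.sum fun i n => n * w i t := by
  rw [Finsupp.linearCombination_apply, Finsupp.sum, Finset.sum_apply]
  rfl

/-- This serves variables occurring in no binomial. The index type `Fin 2 ⊕ σ` is the same for all
components, as gluing requires. -/
theorem hasLocalModel_empty (V : Set σ) :
    HasLocalModel (Fin 2 ⊕ σ) (∅ : Set (MvPolynomial σ k)) V := by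
  classical
  refine ⟨fun i => Pi.single (Sum.inr i) 1, fun _ => 1, by simp, by simp, ?_⟩
  intro u v _ _ h hne
  refine (hne (Finsupp.ext fun i => ?_)).elim
  have key : ∀ u : σ →₀ ℕ, Finsupp.linearCombination ℕ
      (fun i : σ => (Pi.single (Sum.inr i) 1 : Fin 2 ⊕ σ → ℕ)) u (Sum.inr i) = u i := by
    intro u
    rw [linearCombination_apply_apply]
    simp [Pi.single_apply, Finsupp.sum]
    tauto
  rw [← key u, ← key v, h]

theorem single_add_single_le {a b : σ} {u : σ →₀ ℕ} (hab : a ≠ b) (ha : u a ≠ 0) (hb : u b ≠ 0) :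
    Finsupp.single a 1 + Finsupp.single b 1 ≤ u := by
  classical
  intro i
  simp only [Finsupp.add_apply, Finsupp.single_apply]
  split_ifs with h1 h2 h2
  · exact (hab (h1.trans h2.symm)).elim
  · subst h1; omega
  · subst h2; omega
  · omega

theorem hasLocalModel_of_sq {f : MvPolynomial σ k} {x y z : σ} (hxy : x ≠ y) (hxz : x ≠ z)
    (hyz : y ≠ z) (hT : HasTerms f x x y z) {V : Set σ} (hV : ∀ i ∈ V, i ∈ f.vars) :
    HasLocalModel (Fin 2 ⊕ σ) {f} V := by
  classical
  obtain ⟨hα, hβ⟩ := mem_support_of_pair hT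
  have hne : Finsupp.single x 1 + Finsupp.single x 1 ≠
      Finsupp.single y 1 + (Finsupp.single z 1 : σ →₀ ℕ) := by
    intro h
    rcases single_add_single_inj h with h | h
    · exact hxy h.1
    · exact hxz h.1
  have hE : IsBinomialEdge {f} (Finsupp.single x 1 + Finsupp.single x 1)
      (Finsupp.single y 1 + Finsupp.single z 1) := ⟨hne, f, rfl, hT⟩
  -- The weights are `(1,1)`, `(2,0)`, `(0,2)` for `x`, `y`, `z`, so that `xx` and `yz` agree; the
  -- sign and coefficients go into `lam z`.
  let w : σ → Fin 2 ⊕ σ → ℕ := fun i => if i = x then Pi.single (Sum.inl 0) 1 + Pi.single (Sum.inl 1) 1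
    else if i = y then Pi.single (Sum.inl 0) 2 else if i = z then Pi.single (Sum.inl 1) 2 else 0
  let lam : σ → k := fun i => if i = z then - coeff (Finsupp.single x 1 + Finsupp.single x 1) f /
    coeff (Finsupp.single y 1 + Finsupp.single z 1) f else 1
  have hlam : ∀ i, lam i ≠ 0 := by
    intro i
    simp only [lam]
    split_ifs
    · exact div_ne_zero (neg_ne_zero.2 hα) hβ
    · exact one_ne_zero
  have hwx : w x = Pi.single (Sum.inl 0) 1 + Pi.single (Sum.inl 1) 1 := by simp [w]
  have hwy : w y = Pi.single (Sum.inl 0) 2 := by simp [w, hxy.symm]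
  have hwz : w z = Pi.single (Sum.inl 1) 2 := by simp [w, hxz.symm, hyz.symm]
  refine ⟨w, lam, hlam, ?_, ?_⟩
  · rintro _ rfl
    rw [paramHom_eq_zero_iff hlam hne hT]
    constructor
    · simp only [map_add, Finsupp.linearCombination_single, one_smul, hwx, hwy, hwz]
      ext (t | t)
      · fin_cases t <;> simp
      · simp
    · rw [Finsupp.prod_add_index' (by simp) (by simp [pow_add]),
        Finsupp.prod_add_index' (by simp) (by simp [pow_add])]
      simp only [Finsupp.prod_single_index, pow_zero, pow_one, lam, if_neg hxz, if_neg hyz, if_true]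
      field_simp
      ring
  · intro u v hu hv h huv
    have hout : ∀ i, i ≠ x → i ≠ y → i ≠ z → i ∉ V := by
      intro i h1 h2 h3 hi
      have := hT.mem_vars.1 (hV i hi)
      tauto
    have key : ∀ u : σ →₀ ℕ, (∀ i ∉ V, u i = 0) →
        Finsupp.linearCombination ℕ w u (Sum.inl 0) = u x + 2 * u y ∧
        Finsupp.linearCombination ℕ w u (Sum.inl 1) = u x + 2 * u z := by
      intro u hu
      have hsub : u.support ⊆ {x, y, z} := by
        intro i hi
        have := fun h1 h2 h3 => (Finsupp.mem_support_iff.1 hi) (hu i (hout i h1 h2 h3))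
        simp only [Finset.mem_insert, Finset.mem_singleton]
        tauto
      simp only [linearCombination_apply_apply]
      rw [Finsupp.sum_of_support_subset _ hsub _ (by simp),
        Finsupp.sum_of_support_subset _ hsub _ (by simp)]
      rw [Finset.sum_insert (by simp [hxy, hxz]), Finset.sum_pair hyz,
        Finset.sum_insert (by simp [hxy, hxz]), Finset.sum_pair hyz, hwx, hwy, hwz]
      constructor <;> simp [mul_comm]
    have ku := key u hu
    have kv := key v hv
    rw [h] at ku
    have e1 := ku.1.symm.trans kv.1
    have e2 := ku.2.symm.trans kv.2
    have hx : u x ≠ v x := by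
      intro hx
      refine huv (Finsupp.ext fun i => ?_)
      by_cases h1 : i = x
      · rw [h1, hx]
      by_cases h2 : i = y
      · rw [h2]; omega
      by_cases h3 : i = z
      · rw [h3]; omega
      rw [hu i (hout i h1 h2 h3), hv i (hout i h1 h2 h3)]
    have hle2 : ∀ u : σ →₀ ℕ, 2 ≤ u x → Finsupp.single x 1 + Finsupp.single x 1 ≤ u := by
      intro u hu
      rw [← Finsupp.single_add, Finsupp.single_le_iff]
      exact hu
    rcases lt_or_gt_of_ne hx with hlt | hlt
    · exact ⟨_, _, hE.symm, single_add_single_le hyz (by omega) (by omega), hle2 v (by omega)⟩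
    · exact ⟨_, _, hE, hle2 u (by omega), single_add_single_le hyz (by omega) (by omega)⟩

/-- In degree `n` only constant multiples of the generators contribute. The induction runs over all
multiples `q * p` so that it passes through scalars. -/
theorem exists_mem_coeff_ne_zero {G : Set (MvPolynomial σ k)} {n : ℕ}
    (hG : ∀ f ∈ G, f.IsHomogeneous n) {e : σ →₀ ℕ} (he : e.degree = n) {p : MvPolynomial σ k}
    (hp : p ∈ Ideal.span G) (hc : coeff e p ≠ 0) : ∃ f ∈ G, coeff e f ≠ 0 := by
  classical
  by_contra! h
  have key : ∀ q, coeff e (q * p) = 0 := by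
    clear hc
    induction hp using Submodule.span_induction with
    | mem f hf =>
      intro q
      rw [coeff_mul]
      refine Finset.sum_eq_zero fun d hd => ?_
      rw [Finset.HasAntidiagonal.mem_antidiagonal] at hd
      by_cases h0 : coeff d.2 f = 0
      · rw [h0, mul_zero]
      · have h2 : d.2.degree = n := by
          rw [Finsupp.degree_eq_weight_one]
          exact hG f hf h0
        have : d.2 = e := eq_of_le_of_degree_eq (hd ▸ le_add_self) (h2.trans he.symm)
        rw [this, h f hf, mul_zero]
    | zero => simp
    | add f g _ _ hf hg =>
      intro q
      rw [mul_add, coeff_add, hf, hg, add_zero]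
    | smul a f _ hf =>
      intro q
      rw [smul_eq_mul, ← mul_assoc]
      exact hf _
  exact hc (by simpa using key 1)

end LocalModel

theorem linearCombination_eq_sum_of_injective {σ ι M : Type*} [Fintype ι] [AddCommMonoid M]
    {g : ι → σ} (hg : Function.Injective g) (w : σ → M) {u : σ →₀ ℕ}
    (hu : ∀ i ∉ Set.range g, u i = 0) :
    Finsupp.linearCombination ℕ w u = ∑ p, u (g p) • w (g p) := by
  classical
  have hsub : u.support ⊆ Finset.univ.image g := by
    intro i hi
    by_contra h
    exact (Finsupp.mem_support_iff.1 hi) (hu i fun ⟨p, hp⟩ => h (by simp [← hp]))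
  rw [Finsupp.linearCombination_apply, Finsupp.sum_of_support_subset _ hsub _ (by simp),
    Finset.sum_image fun _ _ _ _ h => hg h]

/-- Equal first-row sums force one entry to exceed and another to fall short; the column sums
transfer the opposite inequalities to the second row. -/
theorem exists_lt_of_margins_eq {n : ℕ} {U V : Fin 2 → Fin n → ℕ}
    (hrow : ∑ j, U 0 j = ∑ j, V 0 j) (hcol : ∀ j, U 0 j + U 1 j = V 0 j + V 1 j) (hne : U ≠ V) :
    ∃ i j, i ≠ j ∧ U 0 i ≠ 0 ∧ U 1 j ≠ 0 ∧ V 0 j ≠ 0 ∧ V 1 i ≠ 0 := by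
  have h0 : ¬ ∀ j, U 0 j = V 0 j := by
    intro h
    refine hne (funext fun r => funext fun j => ?_)
    have := hcol j
    have := h j
    fin_cases r
    · exact this
    · change U 1 j = V 1 j
      omega
  have h1 : ∃ i, V 0 i < U 0 i := by
    by_contra! h
    exact h0 fun j => (Finset.sum_eq_sum_iff_of_le fun i _ => h i).1 hrow j (Finset.mem_univ j)
  have h2 : ∃ j, U 0 j < V 0 j := by
    by_contra! h
    exact h0 fun j =>
      ((Finset.sum_eq_sum_iff_of_le fun i _ => h i).1 hrow.symm j (Finset.mem_univ j)).symm
  obtain ⟨i, hi⟩ := h1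
  obtain ⟨j, hj⟩ := h2
  have hci := hcol i
  have hcj := hcol j
  refine ⟨i, j, ?_, by omega, by omega, by omega, by omega⟩
  rintro rfl
  omega

section Determinantal

variable {σ : Type u} {k : Type v} [Field k] {G : Set (MvPolynomial σ k)} {n : ℕ}
  {x : Fin 2 → Fin n → σ} {c : Fin 2 → Fin n → k}

theorem minor_mem_twoMinorsIdeal {R : Type*} [CommRing R] (A : Matrix (Fin 2) (Fin n) R)
    {i j : Fin n} (hij : i ≠ j) : (A.submatrix id ![i, j]).det ∈ twoMinorsIdeal A := by
  rcases lt_or_gt_of_ne hij with h | h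
  · exact Ideal.subset_span ⟨i, j, h, rfl⟩
  · have : (A.submatrix id ![i, j]).det = - (A.submatrix id ![j, i]).det := by
      rw [Matrix.det_fin_two, Matrix.det_fin_two]
      simp
    rw [this]
    exact neg_mem (Ideal.subset_span ⟨j, i, h, rfl⟩)

theorem exists_eq_of_coeff_ne_zero
    (hspan : Ideal.span G = twoMinorsIdeal (Matrix.of fun r j => C (c r j) * X (x r j)))
    {f : MvPolynomial σ k} (hf : f ∈ G) {e : σ →₀ ℕ} (hd : e.degree = 2) (he : coeff e f ≠ 0) :
    ∃ i j, i ≠ j ∧ e = Finsupp.single (x 0 i) 1 + Finsupp.single (x 1 j) 1 := by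
  classical
  have hmem : f ∈ twoMinorsIdeal (Matrix.of fun r j => C (c r j) * X (R := k) (x r j)) :=
    hspan ▸ Ideal.subset_span hf
  obtain ⟨_, ⟨i, j, hij, rfl⟩, h⟩ := exists_mem_coeff_ne_zero (n := 2) (by
    rintro _ ⟨i, j, hij, rfl⟩
    rw [minor_eq]
    refine (isHomogeneous_monomial _ ?_).sub (isHomogeneous_monomial _ ?_) <;> simp) hd hmem he
  rw [minor_eq, coeff_sub, coeff_monomial, coeff_monomial] at h
  split_ifs at h with h1 h2 h2
  · exact ⟨i, j, hij.ne, h1.symm⟩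
  · exact ⟨i, j, hij.ne, h1.symm⟩
  · exact ⟨j, i, hij.ne', h2.symm⟩
  · simp at h

theorem hasLocalModel_of_determinantal (hbin : ∀ f ∈ G, IsQuadraticBinomial f)
    (hx : Function.Injective (Function.uncurry x)) (hc : ∀ r j, c r j ≠ 0)
    (hspan : Ideal.span G = twoMinorsIdeal (Matrix.of fun r j => C (c r j) * X (x r j)))
    {V : Set σ} (hV : V ⊆ variablesOf G) : HasLocalModel (Fin 2 ⊕ σ) G V := by
  classical
  have hxi : ∀ {r s i j}, x r i = x s j ↔ r = s ∧ i = j := by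
    intro r s i j
    rw [← Prod.mk.injEq, ← hx.eq_iff]
    rfl
  -- Each entry is weighted by its row and its column, the column being labelled by its first-row
  -- variable. Weights of exponents are then table margins.
  let w : σ → Fin 2 ⊕ σ → ℕ := Function.extend (Function.uncurry x)
    (fun p => Pi.single (Sum.inl p.1) 1 + Pi.single (Sum.inr (x 0 p.2)) 1) 0
  let lam : σ → k := Function.extend (Function.uncurry x) (fun p => (c p.1 p.2)⁻¹) 1
  have hw : ∀ r j, w (x r j) = Pi.single (Sum.inl r) 1 + Pi.single (Sum.inr (x 0 j)) 1 :=
    fun r j => hx.extend_apply _ _ (r, j)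
  have hl : ∀ r j, lam (x r j) = (c r j)⁻¹ := fun r j => hx.extend_apply _ _ (r, j)
  have hlam : ∀ i, lam i ≠ 0 := by
    intro i
    by_cases h : ∃ p, Function.uncurry x p = i
    · obtain ⟨⟨r, j⟩, rfl⟩ := h
      change lam (x r j) ≠ 0
      rw [hl]
      exact inv_ne_zero (hc r j)
    · simp only [lam, Function.extend_apply' _ _ _ h]
      exact one_ne_zero
  have hG0 : ∀ f ∈ G, paramHom w lam f = 0 := by
    have hle : twoMinorsIdeal (Matrix.of fun r j => C (c r j) * X (R := k) (x r j)) ≤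
        RingHom.ker (paramHom w lam) := by
      refine Ideal.span_le.2 ?_
      rintro _ ⟨i, j, hij, rfl⟩
      change paramHom w lam _ = 0
      rw [minor_eq, map_sub, paramHom_monomial, paramHom_monomial,
        Finsupp.prod_add_index' (by simp) (by simp [pow_add]),
        Finsupp.prod_add_index' (by simp) (by simp [pow_add])]
      simp only [map_add, Finsupp.linearCombination_single, one_smul, hw,
        Finsupp.prod_single_index, pow_zero, pow_one, hl]
      rw [sub_eq_zero]
      congr 1
      · abel
      · have := hc 0 i
        have := hc 0 j
        have := hc 1 i
        have := hc 1 j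
        field_simp
    exact fun f hf => hle (hspan ▸ Ideal.subset_span hf)
  refine ⟨w, lam, hlam, hG0, ?_⟩
  have hVx : ∀ i ∉ Set.range (Function.uncurry x), i ∉ V := by
    rintro t ht htV
    obtain ⟨f, hf, htf⟩ := hV htV
    obtain ⟨d, hd, htd⟩ := (mem_vars_iff_mem_support t).1 htf
    have hd0 := mem_support_iff.1 hd
    have hd2 : d.degree = 2 := by
      rw [Finsupp.degree_eq_weight_one]
      exact (hbin f hf).1 hd0
    obtain ⟨i, j, -, rfl⟩ := exists_eq_of_coeff_ne_zero hspan hf hd2 hd0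
    have : t = x 0 i ∨ t = x 1 j := by
      by_contra h
      rw [not_or] at h
      simp [Ne.symm h.1, Ne.symm h.2] at htd
    rcases this with rfl | rfl
    · exact ht ⟨(0, i), rfl⟩
    · exact ht ⟨(1, j), rfl⟩
  intro u v hu hv h huv
  have key : ∀ u : σ →₀ ℕ, (∀ i ∉ V, u i = 0) →
      Finsupp.linearCombination ℕ w u (Sum.inl 0) = ∑ j, u (x 0 j) ∧
      ∀ j, Finsupp.linearCombination ℕ w u (Sum.inr (x 0 j)) = u (x 0 j) + u (x 1 j) := by
    intro u hu
    rw [linearCombination_eq_sum_of_injective hx w fun i hi => hu i (hVx i hi)]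
    simp only [Fintype.sum_prod_type, Fin.sum_univ_two, Function.uncurry_apply_pair, hw]
    constructor
    · simp
    · intro j
      simp [Pi.single_apply, hxi]
  have ku := key u hu
  rw [h] at ku
  have kv := key v hv
  obtain ⟨i, j, hij, h1, h2, h3, h4⟩ := exists_lt_of_margins_eq
    (U := fun r j => u (x r j)) (V := fun r j => v (x r j)) (ku.1.symm.trans kv.1)
    (fun j => (ku.2 j).symm.trans (kv.2 j)) (by
      intro hUV
      refine huv (Finsupp.ext fun t => ?_)
      by_cases ht : t ∈ Set.range (Function.uncurry x)
      · obtain ⟨⟨r, j⟩, rfl⟩ := ht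
        exact congrFun (congrFun hUV r) j
      · rw [hu t (hVx t ht), hv t (hVx t ht)])
  refine ⟨Finsupp.single (x 0 i) 1 + Finsupp.single (x 1 j) 1,
    Finsupp.single (x 0 j) 1 + Finsupp.single (x 1 i) 1, ?_,
    single_add_single_le (by simp [hxi]) h1 h2, single_add_single_le (by simp [hxi]) h3 h4⟩
  have hne : Finsupp.single (x 0 i) 1 + Finsupp.single (x 1 j) 1 ≠
      Finsupp.single (x 0 j) 1 + (Finsupp.single (x 1 i) 1 : σ →₀ ℕ) := by
    intro h
    have := single_add_single_inj h
    simp [hxi, hij] at this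
  -- Only the ideal of `G` is known, so a member with the terms of this minor must be found: some `f
  -- ∈ G` contains one term, and equal weight identifies the other.
  have hmin := minor_mem_twoMinorsIdeal (Matrix.of fun r j => C (c r j) * X (R := k) (x r j)) hij
  rw [← hspan] at hmin
  obtain ⟨f, hf, hcf⟩ := exists_mem_coeff_ne_zero (n := 2)
    (e := Finsupp.single (x 0 i) 1 + Finsupp.single (x 1 j) 1) (fun f hf => (hbin f hf).1)
    (by simp) hmin (by
      rw [minor_eq, coeff_sub, coeff_monomial, coeff_monomial, if_pos rfl, if_neg hne.symm,
        sub_zero]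
      exact mul_ne_zero (hc _ _) (hc _ _))
  obtain ⟨u1, u2, hu12, hs, hE⟩ := exists_isBinomialEdge hf (hbin f hf).2
  have hex : ∃ e'', IsBinomialEdge G (Finsupp.single (x 0 i) 1 + Finsupp.single (x 1 j) 1) e'' ∧
      (f.support : Set (σ →₀ ℕ)) = {Finsupp.single (x 0 i) 1 + Finsupp.single (x 1 j) 1, e''} := by
    have : Finsupp.single (x 0 i) 1 + Finsupp.single (x 1 j) 1 ∈ (f.support : Set (σ →₀ ℕ)) :=
      mem_support_iff.2 hcf
    rw [hs] at this
    rcases this with h | h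
    · exact ⟨u2, h ▸ hE, h ▸ hs⟩
    · rw [Set.mem_singleton_iff] at h
      exact ⟨u1, h ▸ hE.symm, by rw [hs, h, Set.pair_comm]⟩
  obtain ⟨e'', hE'', hs''⟩ := hex
  have hwt := weight_eq_of_paramHom_eq_zero hlam hE''.1 hs'' (hG0 f hf)
  obtain ⟨i', j', hij', rfl⟩ := exists_eq_of_coeff_ne_zero hspan hf
    (degree_of_isBinomialEdge hbin hE''.symm) (mem_support_of_pair hs'').2
  simp only [map_add, Finsupp.linearCombination_single, one_smul, hw] at hwt
  have hti := congrFun hwt (Sum.inr (x 0 i))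
  have htj := congrFun hwt (Sum.inr (x 0 j))
  simp only [Pi.add_apply, Pi.single_apply, Sum.inr.injEq, hxi, reduceCtorEq, if_false,
    true_and, hij, hij.symm, if_true] at hti htj
  have hii : i ≠ i' := by
    rintro rfl
    have : j = j' := by
      by_contra hjj
      simp [hij.symm, hjj] at htj
    exact hE''.1 (by rw [this])
  have hij2 : i = j' := by
    by_contra hjj
    simp [hii, hjj] at hti
  subst hij2
  have hji : j = i' := by
    by_contra hjj
    simp [hij.symm, hjj] at htj
  subst hji
  exact hE''

theorem isGenericDeterminantal_of_hasTerms {f : MvPolynomial σ k} {p q r s : σ}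
    (hT : HasTerms f p q r s) (hnd : [p, q, r, s].Nodup) :
    IsGenericDeterminantal (Ideal.span {f}) := by
  obtain ⟨hα, hβ⟩ := mem_support_of_pair hT
  have hne : Finsupp.single p 1 + Finsupp.single q 1 ≠
      Finsupp.single r 1 + (Finsupp.single s 1 : σ →₀ ℕ) := by
    intro h
    have := single_add_single_inj h
    simp at hnd
    tauto
  refine ⟨2, ![![p, r], ![s, q]], ![![coeff (Finsupp.single p 1 + Finsupp.single q 1) f,
    - coeff (Finsupp.single r 1 + Finsupp.single s 1) f], ![1, 1]], le_rfl, ?_, ?_, ?_⟩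
  · rintro ⟨a, b⟩ ⟨a', b'⟩ h
    simp at hnd
    fin_cases a <;> fin_cases b <;> fin_cases a' <;> fin_cases b' <;> simp at h ⊢ <;>
      simp_all
  · intro a b
    fin_cases a <;> fin_cases b <;> simp [hα, hβ]
  · rw [twoMinorsIdeal]
    congr 1
    have key := minor_eq ![![p, r], ![s, q]] ![![coeff (Finsupp.single p 1 + Finsupp.single q 1) f,
      - coeff (Finsupp.single r 1 + Finsupp.single s 1) f], ![1, 1]] 0 1
    have hf : f = _ := eq_monomial_add_monomial hne hT
    ext d
    simp only [Set.mem_singleton_iff, Set.mem_ofPred_eq]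
    have hd : ((Matrix.of fun a b => C ((![![coeff (Finsupp.single p 1 + Finsupp.single q 1) f,
      - coeff (Finsupp.single r 1 + Finsupp.single s 1) f], ![1, 1]] : Fin 2 → Fin 2 → k) a b) *
      X (R := k) ((![![p, r], ![s, q]] : Fin 2 → Fin 2 → σ) a b)).submatrix id ![0, 1]).det = f := by
      rw [key]
      conv_rhs => rw [hf]
      simp
    constructor
    · rintro rfl
      exact ⟨0, 1, by simp, hd.symm⟩
    · rintro ⟨i, j, hij, rfl⟩
      obtain ⟨rfl, rfl⟩ : i = 0 ∧ j = 1 := by omega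
      exact hd

end Determinantal

/-- By coprimality and the exclusion of two squares, `f` has either one square term and three
variables, or four distinct variables, when it is a `2 × 2` determinant. -/
theorem hasLocalModel_singleton {σ : Type u} {k : Type v} [Field k] {f : MvPolynomial σ k}
    (hbin : IsQuadraticBinomial f) (hprime : Prime f)
    (hsq : ∀ (i j : σ) (a b : k), f ≠ C a * X i ^ 2 + C b * X j ^ 2)
    {V : Set σ} (hV : V ⊆ variablesOf {f}) : HasLocalModel (Fin 2 ⊕ σ) {f} V := by
  have hbin' : ∀ g ∈ ({f} : Set _), IsQuadraticBinomial g := by simpa using hbin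
  have hprime' : ∀ g ∈ ({f} : Set _), Prime g := by simpa using hprime
  obtain ⟨e, e', hne, hs, hE⟩ := exists_isBinomialEdge (F := {f}) rfl hbin.2
  obtain ⟨p, q, rfl⟩ := exists_eq_single_add_single (degree_of_isBinomialEdge hbin' hE)
  obtain ⟨r, s, rfl⟩ := exists_eq_single_add_single (degree_of_isBinomialEdge hbin' hE.symm)
  have hco : ∀ t, (t ≠ p ∧ t ≠ q) ∨ (t ≠ r ∧ t ≠ s) := by
    intro t
    rcases hE.coprime hprime' hbin' t with h | h
    · exact .inl (pair_apply_eq_zero_iff.1 h)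
    · exact .inr (pair_apply_eq_zero_iff.1 h)
  have hcp := hco p
  have hcq := hco q
  have hV' : ∀ i ∈ V, i ∈ f.vars := by
    intro i hi
    obtain ⟨g, rfl, h⟩ := hV hi
    exact h
  have hT : HasTerms f p q r s := hs
  have hT' : HasTerms f r s p q := by rw [HasTerms, Set.pair_comm]; exact hs
  by_cases hpq : p = q
  · subst hpq
    by_cases hrs : r = s
    · subst hrs
      have h := eq_monomial_add_monomial hne hs
      rw [← Finsupp.single_add, ← Finsupp.single_add, ← C_mul_X_pow_eq_monomial,
        ← C_mul_X_pow_eq_monomial] at h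
      exact (hsq _ _ _ _ h).elim
    · exact hasLocalModel_of_sq (by tauto) (by tauto) hrs hT hV'
  by_cases hrs : r = s
  · subst hrs
    exact hasLocalModel_of_sq (by tauto) (by tauto) hpq hT' hV'
  obtain ⟨n, x, c, -, hx, hc, hspan⟩ := isGenericDeterminantal_of_hasTerms hT (by
    simp
    tauto)
  exact hasLocalModel_of_determinantal hbin' hx hc hspan hV

/-! ### Gluing models over disjoint variables -/

section Gluing

variable {σ : Type u} {k : Type v} [Field k] {F : Set (MvPolynomial σ k)}

/-- Each block of variables receives its own copy of `T`, so a weight equality splits into one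
equality per block. -/
theorem HasLocalModel.glue {S T : Type*} {κ : σ → S} {G : S → Set (MvPolynomial σ k)}
    (hbin : ∀ f ∈ F, IsQuadraticBinomial f)
    (hF : ∀ f ∈ F, ∃ s, f ∈ G s ∧ ∀ i ∈ f.vars, κ i = s) (hGF : ∀ s, G s ⊆ F)
    (hG : ∀ s, HasLocalModel T (G s) {i | κ i = s}) : HasLocalModel (S × T) F Set.univ := by
  classical
  choose w lam hlam hker hedge using hG
  let W : σ → S × T → ℕ := fun i p => if κ i = p.1 then w p.1 i p.2 else 0
  have hW : ∀ (u : σ →₀ ℕ) s t, Finsupp.linearCombination ℕ W u (s, t) =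
      Finsupp.linearCombination ℕ (w s) (u.filter (κ · = s)) t := by
    intro u s t
    rw [linearCombination_apply_apply, linearCombination_apply_apply, Finsupp.sum, Finsupp.sum,
      Finsupp.support_filter, Finset.sum_filter]
    refine Finset.sum_congr rfl fun i _ => ?_
    by_cases h : κ i = s <;> simp [W, h]
  refine ⟨W, fun i => lam (κ i) i, fun i => hlam _ i, ?_, ?_⟩
  · intro f hf
    obtain ⟨s, hfs, hs⟩ := hF f hf
    obtain ⟨e, e', hne, hsupp, hE⟩ := exists_isBinomialEdge hf (hbin f hf).2
    obtain ⟨hw, hc⟩ := (paramHom_eq_zero_iff (hlam s) hne hsupp).1 (hker s f hfs)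
    have hvar : ∀ d ∈ (f.support : Set (σ →₀ ℕ)), ∀ i ∈ d.support, κ i = s :=
      fun d hd i hi => hs i ((mem_vars_iff_mem_support _).2 ⟨d, hd, hi⟩)
    have hve := hvar e (by rw [hsupp]; simp)
    have hve' := hvar e' (by rw [hsupp]; simp)
    refine (paramHom_eq_zero_iff (fun i => hlam _ i) hne hsupp).2 ⟨?_, ?_⟩
    · ext ⟨s', t⟩
      rw [hW, hW]
      by_cases h : s' = s
      · subst h
        rw [Finsupp.filter_eq_self_iff _ _ |>.2 fun i hi => hve i (Finsupp.mem_support_iff.2 hi),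
          Finsupp.filter_eq_self_iff _ _ |>.2 fun i hi => hve' i (Finsupp.mem_support_iff.2 hi), hw]
      · rw [Finsupp.filter_eq_zero_iff _ _ |>.2 fun i hi => ?_,
          Finsupp.filter_eq_zero_iff _ _ |>.2 fun i hi => ?_]
        · by_contra h0
          exact h (hi.symm.trans (hve' i (Finsupp.mem_support_iff.2 h0)))
        · by_contra h0
          exact h (hi.symm.trans (hve i (Finsupp.mem_support_iff.2 h0)))
    · rw [← hc]
      congr 2
      · exact Finsupp.prod_congr fun i hi => by rw [hve i hi]
      · exact Finsupp.prod_congr fun i hi => by rw [hve' i hi]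
  · intro u v _ _ h huv
    -- Two distinct exponents differ in some block, and the binomial refining that block refines the
    -- whole.
    obtain ⟨i, hi⟩ := Finsupp.ne_iff.1 huv
    have hle : ∀ (u : σ →₀ ℕ) s, u.filter (κ · = s) ≤ u := by
      intro u s j
      rw [Finsupp.filter_apply]
      split_ifs <;> simp
    obtain ⟨e, e', ⟨hne, f, hf, hs⟩, he, he'⟩ := hedge (κ i) (u.filter (κ · = κ i))
      (v.filter (κ · = κ i)) (fun j hj => Finsupp.filter_apply_neg _ _ hj)
      (fun j hj => Finsupp.filter_apply_neg _ _ hj)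
      (funext fun t => by rw [← hW, ← hW, h]) (fun h => hi (by
        have := DFunLike.congr_fun h i
        simpa [Finsupp.filter_apply] using this))
    exact ⟨e, e', ⟨hne, f, hGF _ hf, hs⟩, he.trans (hle _ _), he'.trans (hle _ _)⟩

theorem HasLocalModel.isGroebnerBasis {T : Type*} (h : HasLocalModel T F Set.univ)
    (m : MonomialOrder.{u, u} σ) : IsGroebnerBasis m F := by
  obtain ⟨w, lam, hlam, hF, hG⟩ := h
  have hG' := fun u v => hG u v (by simp) (by simp)
  rw [isGroebnerBasis_iff]
  intro f hf h0
  rw [← ker_paramHom_eq hlam hF hG' m] at hf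
  exact exists_degree_le_of_paramHom_eq_zero hlam hF hG' m hf h0

theorem HasLocalModel.isPrime [Finite σ] {T : Type*} (h : HasLocalModel T F Set.univ) :
    (Ideal.span F).IsPrime := by
  obtain ⟨w, lam, hlam, hF, hG⟩ := h
  obtain ⟨_, -⟩ := exists_linearOrder fun _ : σ => 0
  exact isPrime_span_of_paramHom
    (ker_paramHom_eq hlam hF (fun u v => hG u v (by simp) (by simp)) MonomialOrder.lex)

end Gluing

/-! ### Components as classes of linked binomials, and the conclusion -/

section Components

variable {σ : Type u} {k : Type v} [Field k] {F : Set (MvPolynomial σ k)}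
  {f g : MvPolynomial σ k}

/-- Two members of `F` with a variable in common. -/
def ShareVariable (F : Set (MvPolynomial σ k)) (f g : MvPolynomial σ k) : Prop :=
  f ∈ F ∧ g ∈ F ∧ ∃ i, i ∈ f.vars ∧ i ∈ g.vars

/-- The members of `F` linked to `f` by a chain of shared variables. -/
def linkedTo (F : Set (MvPolynomial σ k)) (f : MvPolynomial σ k) : Set (MvPolynomial σ k) :=
  {g | Relation.ReflTransGen (ShareVariable F) f g}

theorem ShareVariable.symm (h : ShareVariable F f g) : ShareVariable F g f := by
  obtain ⟨hf, hg, i, hi, hi'⟩ := h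
  exact ⟨hg, hf, i, hi', hi⟩

theorem linkedTo_subset (hf : f ∈ F) : linkedTo F f ⊆ F := by
  intro g hg
  rcases Relation.ReflTransGen.cases_tail hg with rfl | ⟨_, -, h⟩
  · exact hf
  · exact h.2.1

theorem linkedTo_eq (h : ShareVariable F f g) : linkedTo F f = linkedTo F g := by
  ext p
  exact ⟨fun hp => Relation.ReflTransGen.head h.symm hp, fun hp => Relation.ReflTransGen.head h hp⟩

theorem IsQuadraticBinomial.vars_nonempty (hf : IsQuadraticBinomial f) : f.vars.Nonempty := by
  have h0 : f.support.Nonempty := Finset.card_pos.1 (by rw [hf.2]; norm_num)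
  obtain ⟨d, hd⟩ := h0
  have hd2 : d.degree = 2 := by
    rw [Finsupp.degree_eq_weight_one]
    exact hf.1 (mem_support_iff.1 hd)
  obtain ⟨i, hi⟩ := Finsupp.support_nonempty_iff.2 (show d ≠ 0 by rintro rfl; simp at hd2)
  exact ⟨i, (mem_vars_iff_mem_support _).2 ⟨d, hd, hi⟩⟩

theorem isIrreducibleComponent_linkedTo (hbin : ∀ f ∈ F, IsQuadraticBinomial f) (hf : f ∈ F) :
    IsIrreducibleComponent F (linkedTo F f) := by
  have hsub := linkedTo_subset hf
  refine ⟨⟨f, .refl⟩, ⟨F \ linkedTo F f, (Set.union_sdiff_cancel hsub).symm, ?_⟩, ?_⟩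
  · rw [Set.disjoint_left]
    rintro i ⟨g, hg, hi⟩ ⟨p, ⟨hp, hpn⟩, hi'⟩
    exact hpn (Relation.ReflTransGen.tail hg ⟨hsub hg, hp, i, hi, hi'⟩)
  · have main : ∀ A B, IsVariableDecomposition (linkedTo F f) A B → f ∈ A → B = ∅ := by
      rintro A B ⟨heq, hd⟩ hfA
      rw [Set.disjoint_left] at hd
      have hA : ∀ g ∈ linkedTo F f, g ∈ A := by
        intro g hg
        induction hg with
        | refl => exact hfA
        | tail hp hpq ih =>
          have hq : _ ∈ linkedTo F f := Relation.ReflTransGen.tail hp hpq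
          obtain ⟨-, -, i, hi, hi'⟩ := hpq
          rw [heq] at hq
          exact hq.resolve_right fun hB => hd ⟨_, ih, hi⟩ ⟨_, hB, hi'⟩
      refine Set.eq_empty_of_forall_notMem fun g hg => ?_
      have hgl : g ∈ linkedTo F f := heq ▸ Set.mem_union_right A hg
      obtain ⟨i, hi⟩ := (hbin g (hsub hgl)).vars_nonempty
      exact hd ⟨g, hA g hgl, hi⟩ ⟨g, hg, hi⟩
    intro A B h
    have hfAB : f ∈ A ∪ B := h.1 ▸ Relation.ReflTransGen.refl
    rcases hfAB with hA | hB
    · exact .inr (main A B h hA)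
    · exact .inl (main B A ⟨by rw [Set.union_comm]; exact h.1, h.2.symm⟩ hB)

theorem exists_hasLocalModel (hbin : ∀ f ∈ F, IsQuadraticBinomial f) (hprime : ∀ f ∈ F, Prime f)
    (hsq : ∀ f ∈ F, ∀ (i j : σ) (a b : k), f ≠ C a * X i ^ 2 + C b * X j ^ 2)
    (hcomp : ∀ G, IsIrreducibleComponent F G →
      IsGenericDeterminantal (Ideal.span G) ∨ ∃ f, G = {f}) :
    ∃ T : Type (max u v), HasLocalModel T F Set.univ := by
  -- Blocks are labelled by the component containing the variable; unused variables share the label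
  -- `∅`.
  let κ : σ → Set (MvPolynomial σ k) := fun i => {g | ∃ f ∈ F, i ∈ f.vars ∧ g ∈ linkedTo F f}
  have hκ : ∀ f ∈ F, ∀ i ∈ f.vars, κ i = linkedTo F f := by
    intro f hf i hi
    ext g
    constructor
    · rintro ⟨f', hf', hi', hg⟩
      rwa [linkedTo_eq ⟨hf, hf', i, hi, hi'⟩]
    · exact fun hg => ⟨f, hf, hi, hg⟩
  refine ⟨Set.range κ × (Fin 2 ⊕ σ), HasLocalModel.glue (κ := fun i => ⟨κ i, i, rfl⟩)
    (G := Subtype.val) hbin ?_ ?_ ?_⟩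
  · intro f hf
    obtain ⟨i, hi⟩ := (hbin f hf).vars_nonempty
    exact ⟨⟨κ i, i, rfl⟩, ⟨f, hf, hi, .refl⟩, fun j hj =>
      Subtype.ext ((hκ f hf j hj).trans (hκ f hf i hi).symm)⟩
  · rintro ⟨_, i, rfl⟩ g ⟨f, hf, -, hg⟩
    exact linkedTo_subset hf hg
  · rintro ⟨_, i, rfl⟩
    by_cases hi : ∃ f ∈ F, i ∈ f.vars
    · obtain ⟨f, hf, hi⟩ := hi
      have hi' := hκ f hf i hi
      have hsub : ∀ g ∈ κ i, g ∈ F := fun g hg => linkedTo_subset hf (hi' ▸ hg)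
      have hV : {j | (⟨κ j, j, rfl⟩ : Set.range κ) = ⟨κ i, i, rfl⟩} ⊆ variablesOf (κ i) := by
        intro j hj
        have hj' : κ j = κ i := congrArg Subtype.val hj
        have hfj : f ∈ κ j := by
          rw [hj', hi']
          exact .refl
        obtain ⟨f', hf', hjf, -⟩ := hfj
        exact ⟨f', hj' ▸ ⟨f', hf', hjf, .refl⟩, hjf⟩
      rcases hcomp (κ i) (hi' ▸ isIrreducibleComponent_linkedTo hbin hf) with
        ⟨n, x, c, -, hx, hc, hspan⟩ | ⟨f', hf'⟩
      · exact hasLocalModel_of_determinantal (fun g hg => hbin g (hsub g hg)) hx hc hspan hV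
      · have hmem : f' ∈ F := hsub f' (by rw [hf']; rfl)
        change HasLocalModel _ (κ i) _
        generalize {j | (⟨κ j, j, rfl⟩ : Set.range κ) = ⟨κ i, i, rfl⟩} = V at hV ⊢
        rw [hf'] at hV ⊢
        exact hasLocalModel_singleton (hbin f' hmem) (hprime f' hmem) (hsq f' hmem) hV
    · have : κ i = ∅ := by
        refine Set.eq_empty_of_forall_notMem ?_
        rintro g ⟨f, hf, h, -⟩
        exact hi ⟨f, hf, h⟩
      change HasLocalModel _ (κ i) _
      generalize {j | (⟨κ j, j, rfl⟩ : Set.range κ) = ⟨κ i, i, rfl⟩} = V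
      rw [this]
      exact hasLocalModel_empty _

end Components

theorem corollary2p7 {σ : Type u} [Finite σ] {k : Type v} [Field k]
    (F : Set (MvPolynomial σ k))
    (hbin : ∀ f ∈ F, IsQuadraticBinomial f)
    (hprime : ∀ f ∈ F, Prime f)
    (hsq : ∀ f ∈ F, ∀ (i j : σ) (a b : k),
      f ≠ MvPolynomial.C a * MvPolynomial.X i ^ 2 + MvPolynomial.C b * MvPolynomial.X j ^ 2)
    (hmin : IsMinimalGeneratingSet F) :
    List.TFAE [
      ∀ _ : LinearOrder σ, IsGroebnerBasis MonomialOrder.lex F,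
      ∀ m : MonomialOrder.{u, u} σ, IsGroebnerBasis m F,
      (Ideal.span F).IsPrime ∧ ∀ G, IsIrreducibleComponent F G →
        IsGenericDeterminantal (Ideal.span G) ∨ ∃ f, G = {f}] := by
  tfae_have 2 → 1 := fun h _ => h _
  tfae_have 1 → 3 := by
    intro h
    have hF : IsRobustQuadratic F := ⟨hbin, hprime, hsq, hmin, h⟩
    have hcomp := fun G => hF.isGenericDeterminantal_or_singleton (G := G)
    -- Primality comes from the parametrization built on the classified components.
    obtain ⟨T, hT⟩ := exists_hasLocalModel hbin hprime hsq hcomp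
    exact ⟨hT.isPrime, hcomp⟩
  tfae_have 3 → 2 := by
    intro h m
    obtain ⟨T, hT⟩ := exists_hasLocalModel hbin hprime hsq h.2
    exact hT.isGroebnerBasis m
  tfae_finish
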